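/- Let $X$ be a locally compact Hausdorff space, $A=C_0(X)$, and let $\alpha:A\to A$ be an extendible $*$-endomorphism, i.e. for the canonical approximate unit $(\mu_\lambda)$ of $A$ the net $(\alpha(\mu_\lambda))$ converges strictly in the multiplier algebra $M(A)$; write $\overline{\alpha}:M(A)\to M(A)$ for the strictly continuous extension of $\alpha$. Let $J$ be a closed ideal of $A$ contained in $(\ker\alpha)^\perp=\{a\in A: a\ker\alpha=0\}$, and let $q:A\to A/J$ be the quotient map. Let $\varphi:\Delta\to X$, $\Delta\subseteq X$, be the partial map dual to $\alpha$, that is, $\alpha(a)(x)=a(\varphi(x))$ for $x\in\Delta$ and $\alpha(a)(x)=0$ for $x\notin\Delta$; and let $Y\subseteq X$ be the closed set with $J=\{a\in A: a|_Y=0\}$. The natural reversible $J$-extension $(B,\beta)$ of $(A,\alpha)$ is defined as follows. Put $A_n=\overline{\alpha}^n(1)A\overline{\alpha}^n(1)$, $B_n=q(A_0)\oplus\dots\oplus q(A_{n-1})\oplus A_n$, and let $T_n:B_n\to B_{n+1}$ and $\beta_n:B_n\to B_n$ be given by $$T_n(a_0\oplus\dots\oplus a_n)=a_0\oplus\dots\oplus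 a_{n-1}\oplus q(a_n)\oplus\alpha(a_n),\qquad \beta_n(a_0\oplus\dots\oplus a_n)=a_1\oplus\dots\oplus a_{n-1}\oplus q(a_n)\oplus\alpha(a_n).$$ Then $B=\varinjlim(B_n,T_n)$ is the $C^*$-algebraic direct limit, $\beta$ is the endomorphism of $B$ induced by the $\beta_n$, and $T:A=B_0\to B$ is the canonical map. The algebra $B$ is commutative; let $\widehat B$ be its spectrum, the space of characters of $B$ with the weak-$*$ topology. Let $\{0\}$ be an abstract clopen singleton and let $\widetilde X=\bigcup_{N=0}^\infty X_N\cup X_\infty$ be the subspace of the product space $\prod_{n\in\mathbb N}(X\sqcup\{0\})$, where $$X_N=\{(x_0,\dots,x_N,0,0,\dots): x_n\in\Delta,\ \varphi(x_n)=x_{n-1}\ (1\le n\le N),\ x_N\in Y\},$$ $$X_\infty=\{(x_0,x_1,\dots): x_0\in X,\ x_n\in\Delta,\ \varphi(x_n)=x_{n-1}\ (n\ge 1)\}.$$ Then there is a homeomorphism $\widehat B\cong\widetilde X$ such that, writing $b(\widetilde x)$ for the value at $b\in B$ of the character corresponding to $\widetilde x\in\widetilde X$: 1. $T(a)(x_0,x_1,\dots)=a(x_0)$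 for all $a\in A$; 2. there is a partial homeomorphism $\widetilde\varphi$ of $\widetilde X$, mapping a clopen set $\widetilde\Delta$ homeomorphically onto a clopen set $\widetilde\varphi(\widetilde\Delta)$, which is dual to $\beta$: for all $b\in B$, $\beta(b)(\widetilde x)=b(\widetilde\varphi(\widetilde x))$ if $\widetilde x\in\widetilde\Delta$, and $\beta(b)(\widetilde x)=0$ if $\widetilde x\notin\widetilde\Delta$; 3. $\widetilde\Delta=\{(x_0,x_1,\dots)\in\widetilde X: x_0\in\Delta\}$ and $\widetilde\varphi(\widetilde\Delta)=\{(x_0,x_1,\dots)\in\widetilde X: x_1\ne 0\}$; 4. $\widetilde\varphi(x_0,x_1,\dots)=(\varphi(x_0),x_0,x_1,\dots)$ on $\widetilde\Delta$, and $\widetilde\varphi^{-1}(x_0,x_1,\dots)=(x_1,x_2,\dots)$ on $\widetilde\varphi(\widetilde\Delta)$. -/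

import Mathlib

open Filter Topology
open scoped ENNReal ZeroAtInfty MultiplierAlgebra CStarAlgebra

noncomputable section

namespace CStarDyn

/-! ### Closed ideals and quotient C⋆-algebras -/

/-- A closed two-sided ideal of a C⋆-algebra. Self-adjointness and closure under complex scalars
are automatic for such ideals; they are recorded here because they are used by the algebraic
structure of the quotient. -/
structure ClosedIdeal (A : Type*) [NonUnitalCStarAlgebra A] extends
    NonUnitalStarSubalgebra ℂ A where
  mul_mem_left' : ∀ (a : A) {x : A}, x ∈ carrier → a * x ∈ carrier
  mul_mem_right' : ∀ (a : A) {x : A}, x ∈ carrier → x * a ∈ carrier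
  isClosed' : IsClosed carrier

namespace ClosedIdeal

variable {A : Type*} [NonUnitalCStarAlgebra A]

instance : SetLike (ClosedIdeal A) A where
  coe J := J.carrier
  coe_injective I J h := by
    obtain ⟨I, _, _, _⟩ := I
    obtain ⟨J, _, _, _⟩ := J
    congr
    exact SetLike.coe_injective h

variable (J : ClosedIdeal A)

/-- The underlying closed subspace. -/
abbrev sub : Submodule ℂ A := J.toNonUnitalStarSubalgebra.toNonUnitalSubalgebra.toSubmodule

instance : IsClosed (J.sub : Set A) := J.isClosed'
instance : IsClosed (J.toNonUnitalStarSubalgebra : Set A) := J.isClosed'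

/-- The quotient `A / J`, with the quotient norm. -/
def Quotient : Type _ := A ⧸ J.sub

instance : NormedAddCommGroup J.Quotient := inferInstanceAs (NormedAddCommGroup (A ⧸ J.sub))
instance : NormedSpace ℂ J.Quotient := inferInstanceAs (NormedSpace ℂ (A ⧸ J.sub))
instance : CompleteSpace J.Quotient := inferInstanceAs (CompleteSpace (A ⧸ J.sub))

/-- The quotient map as a linear map. -/
def mkL : A →ₗ[ℂ] J.Quotient := J.sub.mkQ

theorem mkL_surjective : Function.Surjective J.mkL := J.sub.mkQ_surjective

theorem mkL_eq {a b : A} : J.mkL a = J.mkL b ↔ a - b ∈ J :=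
  Submodule.Quotient.eq J.sub

theorem norm_mkL_le (a : A) : ‖J.mkL a‖ ≤ ‖a‖ := Submodule.Quotient.norm_mk_le J.sub a

theorem exists_rep (x : J.Quotient) {ε : ℝ} (hε : 0 < ε) :
    ∃ a, J.mkL a = x ∧ ‖a‖ < ‖x‖ + ε := by
  obtain ⟨a, h1, h2⟩ := Submodule.Quotient.norm_mk_lt (S := J.sub) x hε
  exact ⟨a, h1, h2⟩

instance : Mul J.Quotient where
  mul := _root_.Quotient.map₂ (· * ·) (by
    intro a a' h b b' h'
    rw [← Quotient.eq_iff_equiv] at h h' ⊢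
    have h1 := (Submodule.Quotient.eq J.sub).1 h
    have h2 := (Submodule.Quotient.eq J.sub).1 h'
    refine (Submodule.Quotient.eq J.sub).2 ?_
    have : a * b - a' * b' = (a - a') * b + a' * (b - b') := by noncomm_ring
    rw [this]
    exact J.sub.add_mem (J.mul_mem_right' _ h1) (J.mul_mem_left' _ h2))

theorem mkL_mul (a b : A) : J.mkL (a * b) = J.mkL a * J.mkL b := rfl

instance : Star J.Quotient where
  star := _root_.Quotient.map star (by
    intro a b h
    rw [← Quotient.eq_iff_equiv] at h ⊢
    have h1 := (Submodule.Quotient.eq J.sub).1 h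
    refine (Submodule.Quotient.eq J.sub).2 ?_
    rw [← star_sub]
    exact J.star_mem' h1)

theorem mkL_star (a : A) : J.mkL (star a) = star (J.mkL a) := rfl

instance : NonUnitalNormedRing J.Quotient :=
  { (inferInstance : NormedAddCommGroup J.Quotient) with
    mul := (· * ·)
    left_distrib := by
      intro x y z
      obtain ⟨a, rfl⟩ := J.mkL_surjective x
      obtain ⟨b, rfl⟩ := J.mkL_surjective y
      obtain ⟨c, rfl⟩ := J.mkL_surjective z
      rw [← map_add, ← mkL_mul, ← mkL_mul, ← mkL_mul, ← map_add, mul_add]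
    right_distrib := by
      intro x y z
      obtain ⟨a, rfl⟩ := J.mkL_surjective x
      obtain ⟨b, rfl⟩ := J.mkL_surjective y
      obtain ⟨c, rfl⟩ := J.mkL_surjective z
      rw [← map_add, ← mkL_mul, ← mkL_mul, ← mkL_mul, ← map_add, add_mul]
    zero_mul := by
      intro x
      obtain ⟨a, rfl⟩ := J.mkL_surjective x
      rw [← map_zero J.mkL, ← mkL_mul, zero_mul]
    mul_zero := by
      intro x
      obtain ⟨a, rfl⟩ := J.mkL_surjective x
      rw [← map_zero J.mkL, ← mkL_mul, mul_zero]
    mul_assoc := by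
      intro x y z
      obtain ⟨a, rfl⟩ := J.mkL_surjective x
      obtain ⟨b, rfl⟩ := J.mkL_surjective y
      obtain ⟨c, rfl⟩ := J.mkL_surjective z
      rw [← mkL_mul, ← mkL_mul, ← mkL_mul, ← mkL_mul, mul_assoc]
    norm_mul_le := by
      intro x y
      refine ge_of_tendsto (x := 𝓝[>] (0 : ℝ)) (f := fun ε => (‖x‖ + ε) * (‖y‖ + ε)) ?_ ?_
      · have : Tendsto (fun ε : ℝ => (‖x‖ + ε) * (‖y‖ + ε)) (𝓝 0)
            (𝓝 ((‖x‖ + 0) * (‖y‖ + 0))) := by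
          apply Continuous.tendsto; fun_prop
        simpa using this.mono_left nhdsWithin_le_nhds
      · filter_upwards [self_mem_nhdsWithin] with ε hε
        obtain ⟨a, rfl, ha⟩ := J.exists_rep x hε
        obtain ⟨b, rfl, hb⟩ := J.exists_rep y hε
        rw [← mkL_mul]
        exact (J.norm_mkL_le _).trans ((norm_mul_le a b).trans
          (mul_le_mul ha.le hb.le (norm_nonneg _) ((norm_nonneg _).trans ha.le))) }

instance : StarRing J.Quotient where
  star_involutive := by
    intro x
    obtain ⟨a, rfl⟩ := J.mkL_surjective x
    rw [← mkL_star, ← mkL_star, star_star]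
  star_mul := by
    intro x y
    obtain ⟨a, rfl⟩ := J.mkL_surjective x
    obtain ⟨b, rfl⟩ := J.mkL_surjective y
    rw [← mkL_mul, ← mkL_star, ← mkL_star, ← mkL_star, ← mkL_mul, star_mul]
  star_add := by
    intro x y
    obtain ⟨a, rfl⟩ := J.mkL_surjective x
    obtain ⟨b, rfl⟩ := J.mkL_surjective y
    rw [← map_add, ← mkL_star, ← mkL_star, ← mkL_star, ← map_add, star_add]

/-- The estimate behind the C⋆-identity of the quotient. -/
theorem norm_mkL_mul_self_le (a x : A) (hx : x ∈ J) :
    ‖J.mkL a‖ * ‖J.mkL a‖ ≤ ‖star a * a + x‖ := by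
  let _ := CStarAlgebra.spectralOrder J.toNonUnitalStarSubalgebra
  have _ := CStarAlgebra.spectralOrderedRing J.toNonUnitalStarSubalgebra
  set l := CStarAlgebra.approximateUnit J.toNonUnitalStarSubalgebra
  have hl := CStarAlgebra.increasingApproximateUnit J.toNonUnitalStarSubalgebra
  let x' : J.toNonUnitalStarSubalgebra := ⟨x, hx⟩
  have ht : Tendsto (fun e : J.toNonUnitalStarSubalgebra =>
      ‖star a * a + x‖ + ‖x' - e * x'‖) l (𝓝 (‖star a * a + x‖ + ‖x' - x'‖)) :=
    ((tendsto_const_nhds.sub (hl.tendsto_mul_right x')).norm).const_add _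
  rw [sub_self, norm_zero, add_zero] at ht
  have hne : l.NeBot := inferInstance
  refine ge_of_tendsto ht ?_
  filter_upwards [hl.eventually_norm, hl.eventually_nonneg] with e he hpos
  obtain ⟨y, hy⟩ := CStarAlgebra.nonneg_iff_eq_star_mul_self.1 hpos
  let _ := CStarAlgebra.spectralOrder (Unitization ℂ A)
  have _ := CStarAlgebra.spectralOrderedRing (Unitization ℂ A)
  set u : Unitization ℂ A := ((e : A) : Unitization ℂ A) with hu
  have hu0 : 0 ≤ u := by
    have : u = star ((y : A) : Unitization ℂ A) * ((y : A) : Unitization ℂ A) := by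
      rw [hu, hy, ← Unitization.inr_star, ← Unitization.inr_mul]
      rfl
    rw [this]
    exact star_mul_self_nonneg _
  have hu1 : u ≤ 1 := by
    rw [← CStarAlgebra.norm_le_one_iff_of_nonneg u hu0, hu, Unitization.norm_inr]
    exact he
  have hv1 : ‖1 - u‖ ≤ 1 := by
    rw [CStarAlgebra.norm_le_one_iff_of_nonneg (1 - u) (sub_nonneg.2 hu1)]
    simpa using hu0
  have hsu : star u = u := (IsSelfAdjoint.of_nonneg hu0).star_eq
  have hmk : J.mkL a = J.mkL (a - a * e) := by
    rw [mkL_eq, sub_sub_cancel]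
    exact J.mul_mem_left' a e.2
  have hc : ((a - a * e : A) : Unitization ℂ A) = a * (1 - u) := by
    rw [Unitization.inr_sub, Unitization.inr_mul, mul_sub, mul_one]
  have hx' : ‖x' - e * x'‖ = ‖(1 - u) * (x : Unitization ℂ A)‖ := by
    rw [sub_mul, one_mul, hu, ← Unitization.inr_mul, ← Unitization.inr_sub, Unitization.norm_inr]
    rfl
  calc ‖J.mkL a‖ * ‖J.mkL a‖ ≤ ‖a - a * e‖ * ‖a - a * e‖ := by
        rw [hmk]
        exact mul_self_le_mul_self (norm_nonneg _) (J.norm_mkL_le _)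
    _ = ‖(1 - u) * ((star a * a + x : A) : Unitization ℂ A) * (1 - u)
          - (1 - u) * (x : Unitization ℂ A) * (1 - u)‖ := by
        rw [← Unitization.norm_inr (𝕜 := ℂ) (a - a * e), ← CStarRing.norm_star_mul_self, hc,
          star_mul, star_sub, star_one, hsu, Unitization.inr_add, Unitization.inr_mul,
          Unitization.inr_star]
        congr 1
        noncomm_ring
    _ ≤ ‖1 - u‖ * ‖((star a * a + x : A) : Unitization ℂ A)‖ * ‖1 - u‖
          + ‖(1 - u) * (x : Unitization ℂ A)‖ * ‖1 - u‖ := by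
        refine (norm_sub_le _ _).trans (add_le_add ?_ (norm_mul_le _ _))
        exact (norm_mul_le _ _).trans
          (mul_le_mul_of_nonneg_right (norm_mul_le _ _) (norm_nonneg _))
    _ ≤ ‖star a * a + x‖ + ‖x' - e * x'‖ := by
        rw [Unitization.norm_inr, hx']
        refine add_le_add ?_ (mul_le_of_le_one_right (norm_nonneg _) hv1)
        refine (mul_le_of_le_one_right (by positivity) hv1).trans ?_
        exact mul_le_of_le_one_left (norm_nonneg _) hv1

instance : CStarRing J.Quotient where
  norm_mul_self_le := by
    intro q
    obtain ⟨a, rfl⟩ := J.mkL_surjective q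
    refine le_of_forall_pos_le_add fun ε hε => ?_
    obtain ⟨b, hb, hb'⟩ := J.exists_rep (star (J.mkL a) * J.mkL a) hε
    rw [← mkL_star, ← mkL_mul, mkL_eq] at hb
    have := J.norm_mkL_mul_self_le a (b - star a * a) hb
    rw [add_sub_cancel] at this
    exact this.trans hb'.le

instance : NonUnitalCStarAlgebra J.Quotient where
  smul_assoc := by
    intro c x y
    obtain ⟨a, rfl⟩ := J.mkL_surjective x
    obtain ⟨b, rfl⟩ := J.mkL_surjective y
    rw [smul_eq_mul, smul_eq_mul, ← map_smul, ← mkL_mul, ← mkL_mul, ← map_smul, smul_mul_assoc]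
  smul_comm := by
    intro c x y
    obtain ⟨a, rfl⟩ := J.mkL_surjective x
    obtain ⟨b, rfl⟩ := J.mkL_surjective y
    rw [smul_eq_mul, smul_eq_mul, ← map_smul, ← mkL_mul, ← mkL_mul, ← map_smul, mul_smul_comm]
  star_smul := by
    intro c x
    obtain ⟨a, rfl⟩ := J.mkL_surjective x
    rw [← map_smul, ← mkL_star, ← mkL_star, star_smul, map_smul]

/-- The quotient map `A → A / J` as a ⋆-homomorphism. -/
def proj : A →⋆ₙₐ[ℂ] J.Quotient where
  toFun := J.mkL
  map_smul' := J.mkL.map_smul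
  map_zero' := J.mkL.map_zero
  map_add' := J.mkL.map_add
  map_mul' := J.mkL_mul
  map_star' := J.mkL_star

theorem proj_surjective : Function.Surjective J.proj := J.mkL_surjective

theorem proj_mul (a b : A) : J.proj (a * b) = J.proj a * J.proj b := map_mul J.proj a b

theorem proj_eq {a b : A} : J.proj a = J.proj b ↔ a - b ∈ J := J.mkL_eq

theorem proj_eq_zero {a : A} : J.proj a = 0 ↔ a ∈ J := by
  rw [← map_zero J.proj, proj_eq, sub_zero]

variable {C : Type*} [NonUnitalCStarAlgebra C]

/-- The homomorphism on `A / J` induced by a ⋆-homomorphism that vanishes on `J`. -/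
def lift (f : A →⋆ₙₐ[ℂ] C) (hf : ∀ a ∈ J, f a = 0) : J.Quotient →⋆ₙₐ[ℂ] C :=
  have key : ∀ q : J.Quotient, ∀ a, J.proj a = q →
      f (Function.surjInv J.proj_surjective q) = f a := fun q a ha => by
    rw [← sub_eq_zero, ← map_sub]
    exact hf _ (J.proj_eq.1 ((Function.surjInv_eq J.proj_surjective q).trans ha.symm))
  { toFun := fun q => f (Function.surjInv J.proj_surjective q)
    map_smul' := by
      intro c q
      obtain ⟨a, rfl⟩ := J.proj_surjective q
      rw [key _ (c • a) (map_smul _ _ _), key _ a rfl, map_smul]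
      rfl
    map_zero' := by rw [key 0 0 (map_zero _), map_zero]
    map_add' := by
      intro x y
      obtain ⟨a, rfl⟩ := J.proj_surjective x
      obtain ⟨b, rfl⟩ := J.proj_surjective y
      rw [key _ (a + b) (map_add _ _ _), key _ a rfl, key _ b rfl, map_add]
    map_mul' := by
      intro x y
      obtain ⟨a, rfl⟩ := J.proj_surjective x
      obtain ⟨b, rfl⟩ := J.proj_surjective y
      rw [key _ (a * b) (map_mul _ _ _), key _ a rfl, key _ b rfl, map_mul]
    map_star' := by
      intro x
      obtain ⟨a, rfl⟩ := J.proj_surjective x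
      rw [key _ (star a) (map_star _ _), key _ a rfl, map_star] }

@[simp]
theorem lift_proj (f : A →⋆ₙₐ[ℂ] C) (hf : ∀ a ∈ J, f a = 0) (a : A) :
    J.lift f hf (J.proj a) = f a := by
  change f (Function.surjInv J.proj_surjective (J.proj a)) = f a
  rw [← sub_eq_zero, ← map_sub]
  exact hf _ (J.proj_eq.1 (Function.surjInv_eq J.proj_surjective _))

/-- The kernel of a ⋆-homomorphism. -/
def ker (f : A →⋆ₙₐ[ℂ] C) : ClosedIdeal A where
  carrier := {a | f a = 0}
  mul_mem' {a b} ha hb := by simp_all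
  add_mem' {a b} ha hb := by simp_all
  zero_mem' := by simp
  smul_mem' c {a} ha := by simp_all
  star_mem' {a} (ha : f a = 0) := show f (star a) = 0 by rw [map_star, ha, star_zero]
  mul_mem_left' a {x} hx := by simp_all
  mul_mem_right' a {x} hx := by simp_all
  isClosed' := isClosed_eq (map_continuous f) continuous_const

theorem mem_ker {f : A →⋆ₙₐ[ℂ] C} {a : A} : a ∈ ker f ↔ f a = 0 := Iff.rfl

/-- The range of a ⋆-homomorphism of C⋆-algebras is closed. -/
theorem isClosed_range (f : A →⋆ₙₐ[ℂ] C) : IsClosed (Set.range f) := by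
  let g := (ker f).lift f (fun _ h => h)
  have hg : Function.Injective g := by
    rw [injective_iff_map_eq_zero]
    intro q hq
    obtain ⟨a, rfl⟩ := (ker f).proj_surjective q
    exact (proj_eq_zero _).2 ((lift_proj _ _ _ a).symm.trans hq)
  have hr : Set.range f = Set.range g := by
    ext c
    constructor
    · rintro ⟨a, rfl⟩
      exact ⟨(ker f).proj a, lift_proj _ _ _ a⟩
    · rintro ⟨q, rfl⟩
      obtain ⟨a, rfl⟩ := (ker f).proj_surjective q
      exact ⟨a, (lift_proj _ _ _ a).symm⟩
  rw [hr]
  exact (NonUnitalStarAlgHom.isometry g hg).isClosedEmbedding.isClosed_range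

/-- The image of a closed ⋆-subalgebra under a ⋆-homomorphism is closed. -/
theorem isClosed_map (f : A →⋆ₙₐ[ℂ] C) (S : NonUnitalStarSubalgebra ℂ A)
    (hS : IsClosed (S : Set A)) : IsClosed (S.map f : Set C) := by
  have h := isClosed_range (f.comp (NonUnitalStarSubalgebraClass.subtype S))
  convert h using 1
  ext c
  simp

end ClosedIdeal
/-! ### Direct limits of sequences of C⋆-algebras -/

section DirectLimit

variable (E : ℕ → Type*) [∀ n, NonUnitalCStarAlgebra (E n)]

/-- The ideal of null sequences in the C⋆-algebra of all bounded sequences. -/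
def nullIdeal : ClosedIdeal (lp E ∞) where
  carrier := {x | Tendsto (fun n => ‖x n‖) atTop (𝓝 0)}
  mul_mem' {x y} hx hy := by
    have h := Tendsto.mul hx hy
    rw [mul_zero] at h
    exact squeeze_zero (fun _ => norm_nonneg _) (fun n => norm_mul_le (x n) (y n)) h
  add_mem' {x y} hx hy := by
    have h := Tendsto.add hx hy
    rw [add_zero] at h
    exact squeeze_zero (fun _ => norm_nonneg _) (fun n => norm_add_le (x n) (y n)) h
  zero_mem' := by simp
  smul_mem' c {x} hx := by
    have h := Tendsto.const_mul ‖c‖ hx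
    rw [mul_zero] at h
    exact squeeze_zero (fun _ => norm_nonneg _) (fun n => norm_smul_le c (x n)) h
  star_mem' {x} hx := by
    have h : Tendsto (fun n => ‖x n‖) atTop (𝓝 0) := hx
    simpa using h
  mul_mem_left' x {y} hy := by
    have h := Tendsto.const_mul ‖x‖ hy
    rw [mul_zero] at h
    exact squeeze_zero (fun _ => norm_nonneg _) (fun n => (norm_mul_le (x n) (y n)).trans
      (mul_le_mul_of_nonneg_right (lp.norm_apply_le_norm ENNReal.top_ne_zero x n)
        (norm_nonneg _))) h
  mul_mem_right' y {x} hx := by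
    have h := Tendsto.mul_const ‖y‖ hx
    rw [zero_mul] at h
    exact squeeze_zero (fun _ => norm_nonneg _) (fun n => (norm_mul_le (x n) (y n)).trans
      (mul_le_mul_of_nonneg_left (lp.norm_apply_le_norm ENNReal.top_ne_zero y n)
        (norm_nonneg _))) h
  isClosed' := by
    refine isClosed_of_closure_subset fun x hx => ?_
    rw [Metric.mem_closure_iff] at hx
    change Tendsto (fun n => ‖x n‖) atTop (𝓝 0)
    rw [Metric.tendsto_atTop]
    intro ε hε
    obtain ⟨y, hy, hxy⟩ := hx (ε / 2) (half_pos hε)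
    obtain ⟨N, hN⟩ := Metric.tendsto_atTop.1 hy (ε / 2) (half_pos hε)
    refine ⟨N, fun n hn => ?_⟩
    have h1 := hN n hn
    rw [dist_zero_right, norm_norm] at h1 ⊢
    rw [dist_eq_norm] at hxy
    have h2 : ‖x n - y n‖ ≤ ‖x - y‖ := lp.norm_apply_le_norm ENNReal.top_ne_zero (x - y) n
    have h3 : ‖x n‖ ≤ ‖x n - y n‖ + ‖y n‖ := by
      simpa using norm_add_le (x n - y n) (y n)
    linarith

variable {E}
variable (T : ∀ n, E n →⋆ₙₐ[ℂ] E (n + 1))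

/-- The bounded sequences `x` that satisfy `x (n + 1) = T n (x n)` from some index on. -/
def coherent : NonUnitalStarSubalgebra ℂ (lp E ∞) where
  carrier := {x | ∃ N, ∀ n, N ≤ n → x (n + 1) = T n (x n)}
  mul_mem' {x y} := by
    rintro ⟨N, hN⟩ ⟨M, hM⟩
    refine ⟨max N M, fun n hn => ?_⟩
    change x (n + 1) * y (n + 1) = T n (x n * y n)
    rw [hN n (le_of_max_le_left hn), hM n (le_of_max_le_right hn), map_mul]
  add_mem' {x y} := by
    rintro ⟨N, hN⟩ ⟨M, hM⟩
    refine ⟨max N M, fun n hn => ?_⟩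
    change x (n + 1) + y (n + 1) = T n (x n + y n)
    rw [hN n (le_of_max_le_left hn), hM n (le_of_max_le_right hn), map_add]
  zero_mem' := ⟨0, fun n _ => (map_zero (T n)).symm⟩
  smul_mem' c {x} := by
    rintro ⟨N, hN⟩
    refine ⟨N, fun n hn => ?_⟩
    change c • x (n + 1) = T n (c • x n)
    rw [hN n hn, map_smul]
  star_mem' {x} := by
    rintro ⟨N, hN⟩
    refine ⟨N, fun n hn => ?_⟩
    change star (x (n + 1)) = T n (star (x n))
    rw [hN n hn, map_star]

/-- The C⋆-algebraic direct limit of the sequence `E 0 → E 1 → E 2 → ⋯` with bonding maps `T n`: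
the closure, in the algebra of bounded sequences modulo null sequences, of the classes of the
sequences that are eventually coherent. -/
def limitSubalgebra : NonUnitalStarSubalgebra ℂ (nullIdeal E).Quotient :=
  ((coherent T).map (nullIdeal E).proj).topologicalClosure

instance : IsClosed (limitSubalgebra T : Set (nullIdeal E).Quotient) :=
  NonUnitalStarSubalgebra.isClosed_topologicalClosure _

/-- The underlying type of the direct limit. -/
def Limit : Type _ := limitSubalgebra T

instance : NonUnitalCStarAlgebra (Limit T) :=
  inferInstanceAs (NonUnitalCStarAlgebra (limitSubalgebra T))

/-- The inclusion of the direct limit into bounded sequences modulo null sequences. -/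
def Limit.incl : Limit T →⋆ₙₐ[ℂ] (nullIdeal E).Quotient :=
  NonUnitalStarSubalgebraClass.subtype (limitSubalgebra T)

variable {T}
variable (β : ∀ n, E n →⋆ₙₐ[ℂ] E n)

/-- Coordinatewise application of a sequence of endomorphisms to bounded sequences. -/
def seqMap : lp E ∞ →⋆ₙₐ[ℂ] lp E ∞ where
  toFun x := ⟨fun n => β n (x n), memℓp_infty ⟨‖x‖, by
    rintro _ ⟨n, rfl⟩
    exact (NonUnitalStarAlgHom.norm_apply_le (β n) (x n)).trans
      (lp.norm_apply_le_norm ENNReal.top_ne_zero x n)⟩⟩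
  map_smul' c x := lp.ext (funext fun n => map_smul (β n) c (x n))
  map_zero' := lp.ext (funext fun n => map_zero (β n))
  map_add' x y := lp.ext (funext fun n => map_add (β n) (x n) (y n))
  map_mul' x y := lp.ext (funext fun n => map_mul (β n) (x n) (y n))
  map_star' x := lp.ext (funext fun n => map_star (β n) (x n))

theorem seqMap_apply (x : lp E ∞) (n : ℕ) : seqMap β x n = β n (x n) := rfl

/-- Coordinatewise application on bounded sequences modulo null sequences. -/
def seqQuotientMap : (nullIdeal E).Quotient →⋆ₙₐ[ℂ] (nullIdeal E).Quotient :=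
  (nullIdeal E).lift ((nullIdeal E).proj.comp (seqMap β)) fun x hx =>
    (ClosedIdeal.proj_eq_zero _).2 (squeeze_zero (fun _ => norm_nonneg _)
      (fun n => NonUnitalStarAlgHom.norm_apply_le (β n) (x n)) hx)

theorem seqQuotientMap_mem (hβ : ∀ n x, T n (β n x) = β (n + 1) (T n x)) (b : Limit T) :
    seqQuotientMap β (Limit.incl T b) ∈ limitSubalgebra T := by
  obtain ⟨b, hb⟩ := b
  change b ∈ closure _ at hb
  refine map_mem_closure (map_continuous (seqQuotientMap β)) hb ?_
  rintro _ ⟨x, ⟨N, hN⟩, rfl⟩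
  refine ⟨seqMap β x, ⟨N, fun n hn => ?_⟩, ?_⟩
  · rw [seqMap_apply, seqMap_apply, hN n hn, hβ]
  · exact ((nullIdeal E).lift_proj ((nullIdeal E).proj.comp (seqMap β)) _ x).symm

/-- The endomorphism of the direct limit induced by a sequence of endomorphisms that commute with
the bonding maps. -/
def Limit.endo (hβ : ∀ n x, T n (β n x) = β (n + 1) (T n x)) : Limit T →⋆ₙₐ[ℂ] Limit T :=
  NonUnitalStarAlgHom.codRestrict
    ((seqQuotientMap β).comp (Limit.incl T))
    (limitSubalgebra T) (seqQuotientMap_mem β hβ)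

variable (T)

/-- The orbit `b, T 0 b, T 1 (T 0 b), …` of an element of `E 0`. -/
def orbitSeq (b : E 0) : ∀ n, E n
  | 0 => b
  | n + 1 => T n (orbitSeq b n)

theorem norm_orbitSeq_le (b : E 0) (n : ℕ) : ‖orbitSeq T b n‖ ≤ ‖b‖ := by
  induction n with
  | zero => exact le_rfl
  | succ n ih => exact (NonUnitalStarAlgHom.norm_apply_le (T n) _).trans ih

/-- The orbit map as a ⋆-homomorphism into bounded sequences. -/
def orbitHom : E 0 →⋆ₙₐ[ℂ] lp E ∞ where
  toFun b := ⟨orbitSeq T b, memℓp_infty ⟨‖b‖, by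
    rintro _ ⟨n, rfl⟩
    exact norm_orbitSeq_le T b n⟩⟩
  map_smul' c b := lp.ext (funext fun n => by
    change orbitSeq T (c • b) n = c • orbitSeq T b n
    induction n with
    | zero => rfl
    | succ n ih => rw [orbitSeq, ih, map_smul]; rfl)
  map_zero' := lp.ext (funext fun n => by
    change orbitSeq T 0 n = 0
    induction n with
    | zero => rfl
    | succ n ih => rw [orbitSeq, ih, map_zero])
  map_add' a b := lp.ext (funext fun n => by
    change orbitSeq T (a + b) n = orbitSeq T a n + orbitSeq T b n
    induction n with
    | zero => rfl
    | succ n ih => rw [orbitSeq, ih, map_add]; rfl)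
  map_mul' a b := lp.ext (funext fun n => by
    change orbitSeq T (a * b) n = orbitSeq T a n * orbitSeq T b n
    induction n with
    | zero => rfl
    | succ n ih => rw [orbitSeq, ih, map_mul]; rfl)
  map_star' b := lp.ext (funext fun n => by
    change orbitSeq T (star b) n = star (orbitSeq T b n)
    induction n with
    | zero => rfl
    | succ n ih => rw [orbitSeq, ih, map_star]; rfl)

/-- The natural map from the first algebra of the sequence into the direct limit. -/
def Limit.ofZero : E 0 →⋆ₙₐ[ℂ] Limit T :=
  NonUnitalStarAlgHom.codRestrict ((nullIdeal E).proj.comp (orbitHom T)) (limitSubalgebra T)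
    fun b => NonUnitalStarSubalgebra.le_topologicalClosure _
      ⟨orbitHom T b, ⟨0, fun _ _ => rfl⟩, rfl⟩

end DirectLimit

/-! ### C⋆-dynamical systems -/

section System

variable {A : Type*} [NonUnitalCStarAlgebra A]

variable (A) in
/-- The canonical increasing approximate unit of a C⋆-algebra. -/
def unitFilter : Filter A :=
  let _ := CStarAlgebra.spectralOrder A
  have _ := CStarAlgebra.spectralOrderedRing A
  CStarAlgebra.approximateUnit A

variable (A) in
theorem unitFilter_spec : (unitFilter A).NeBot ∧ (∀ᶠ u in unitFilter A, ‖u‖ ≤ 1) ∧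
    (∀ᶠ u in unitFilter A, star u = u) ∧
    (∀ a : A, Tendsto (fun u => u * a) (unitFilter A) (𝓝 a)) ∧
    ∀ a : A, Tendsto (fun u => a * u) (unitFilter A) (𝓝 a) := by
  let _ := CStarAlgebra.spectralOrder A
  have _ := CStarAlgebra.spectralOrderedRing A
  have hl := CStarAlgebra.increasingApproximateUnit A
  exact ⟨inferInstanceAs (CStarAlgebra.approximateUnit A).NeBot, hl.eventually_norm,
    hl.eventually_star_eq, hl.tendsto_mul_right, hl.tendsto_mul_left⟩

instance : (unitFilter A).NeBot := (unitFilter_spec A).1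

/-- The multiplier `p` is the strict limit of `f u` as `u` runs through the approximate unit. -/
def IsStrictLimit (f : A → A) (p : 𝓜(ℂ, A)) : Prop :=
  ∀ a : A, Tendsto (fun u => f u * a) (unitFilter A) (𝓝 (p.fst a)) ∧
    Tendsto (fun u => a * f u) (unitFilter A) (𝓝 (p.snd a))

/-- An endomorphism is extendible if it maps the approximate unit to a strictly convergent net;
the limit is then the image of `1` under the strictly continuous extension to multipliers. -/
def IsExtendible (α : A →⋆ₙₐ[ℂ] A) : Prop := ∃ p : 𝓜(ℂ, A), IsStrictLimit α p

theorem isClosed_tendsto (F : A → A → A)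
    (hF : ∀ᶠ u in unitFilter A, ∀ x y, ‖F u x - F u y‖ ≤ ‖x - y‖) :
    IsClosed {a | Tendsto (fun u => F u a) (unitFilter A) (𝓝 a)} := by
  refine isClosed_of_closure_subset fun a ha => ?_
  rw [Metric.mem_closure_iff] at ha
  change Tendsto _ _ _
  rw [Metric.tendsto_nhds]
  intro ε hε
  obtain ⟨b, hb, hab⟩ := ha (ε / 3) (by positivity)
  filter_upwards [hF, Metric.tendsto_nhds.1 hb (ε / 3) (by positivity)] with u hu hub
  have h1 := hu a b
  rw [← dist_eq_norm, ← dist_eq_norm] at h1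
  have h2 := dist_triangle4 (F u a) (F u b) b a
  rw [dist_comm b a] at h2
  linarith

variable (α : A →⋆ₙₐ[ℂ] A)

theorem norm_pow_mul_sub_le (n : ℕ) :
    ∀ᶠ u in unitFilter A, ∀ x y, ‖(α ^ n) u * x - (α ^ n) u * y‖ ≤ ‖x - y‖ := by
  filter_upwards [(unitFilter_spec A).2.1] with u hu x y
  rw [← mul_sub]
  exact (norm_mul_le _ _).trans (mul_le_of_le_one_left (norm_nonneg _)
    ((NonUnitalStarAlgHom.norm_apply_le (α ^ n) u).trans hu))

theorem norm_mul_pow_sub_le (n : ℕ) :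
    ∀ᶠ u in unitFilter A, ∀ x y, ‖x * (α ^ n) u - y * (α ^ n) u‖ ≤ ‖x - y‖ := by
  filter_upwards [(unitFilter_spec A).2.1] with u hu x y
  rw [← sub_mul]
  exact (norm_mul_le _ _).trans (mul_le_of_le_one_right (norm_nonneg _)
    ((NonUnitalStarAlgHom.norm_apply_le (α ^ n) u).trans hu))

/-- The corner `p A p`, where the projection `p` is the strict limit of `α ^ n` along the
approximate unit (the image of `1` under the extension of `α ^ n` to multipliers): it consists of
the elements `a` with `p a = a = a p`; see `mem_corner_iff`. -/
def corner (n : ℕ) : NonUnitalStarSubalgebra ℂ A where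
  carrier := {a | Tendsto (fun u => (α ^ n) u * a) (unitFilter A) (𝓝 a) ∧
    Tendsto (fun u => a * (α ^ n) u) (unitFilter A) (𝓝 a)}
  mul_mem' {a b} ha hb := by
    refine ⟨?_, ?_⟩
    · simpa only [mul_assoc] using ha.1.mul_const b
    · simpa only [mul_assoc] using hb.2.const_mul a
  add_mem' {a b} ha hb := by
    refine ⟨?_, ?_⟩
    · simpa only [mul_add] using ha.1.add hb.1
    · simpa only [add_mul] using ha.2.add hb.2
  zero_mem' := by simp
  smul_mem' c {a} ha := by
    refine ⟨?_, ?_⟩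
    · simpa only [mul_smul_comm] using ha.1.const_smul c
    · simpa only [smul_mul_assoc] using ha.2.const_smul c
  star_mem' {a} ha := by
    refine ⟨ha.2.star.congr' ?_, ha.1.star.congr' ?_⟩
    · filter_upwards [(unitFilter_spec A).2.2.1] with u hu
      rw [star_mul, ← map_star, hu]
    · filter_upwards [(unitFilter_spec A).2.2.1] with u hu
      rw [star_mul, ← map_star, hu]

instance (n : ℕ) : IsClosed (corner α n : Set A) :=
  (isClosed_tendsto (fun u a => (α ^ n) u * a) (norm_pow_mul_sub_le α n)).inter
    (isClosed_tendsto (fun u a => a * (α ^ n) u) (norm_mul_pow_sub_le α n))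

theorem mem_corner_iff (n : ℕ) (p : 𝓜(ℂ, A)) (hp : IsStrictLimit (α ^ n) p) (a : A) :
    a ∈ corner α n ↔ ∃ b, a = p.snd (p.fst b) := by
  have hl := unitFilter_spec A
  constructor
  · rintro ⟨h1, h2⟩
    refine ⟨a, ?_⟩
    rw [tendsto_nhds_unique (hp a).1 h1, tendsto_nhds_unique (hp a).2 h2]
  · rintro ⟨b, rfl⟩
    have hs : ∀ v, p.snd ((α ^ n) v) = (α ^ n) v := fun v => by
      refine tendsto_nhds_unique (hp ((α ^ n) v)).2 ?_
      simpa only [Function.comp_def, map_mul] using ((map_continuous (α ^ n)).tendsto v).comp (hl.2.2.2.2 v)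
    have hf : ∀ v, p.fst ((α ^ n) v) = (α ^ n) v := fun v => by
      refine tendsto_nhds_unique (hp ((α ^ n) v)).1 ?_
      simpa only [Function.comp_def, map_mul] using ((map_continuous (α ^ n)).tendsto v).comp (hl.2.2.2.1 v)
    have hm : ∀ x y, p.snd (x * y) = x * p.snd y := fun x y => by
      refine tendsto_nhds_unique (hp (x * y)).2 ?_
      simpa only [mul_assoc] using (hp y).2.const_mul x
    refine ⟨?_, ?_⟩
    · have : Tendsto (fun u => p.snd ((α ^ n) u * b)) (unitFilter A) (𝓝 (p.snd (p.fst b))) :=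
        (p.snd.continuous.tendsto _).comp (hp b).1
      refine this.congr fun u => ?_
      rw [← hm, ← p.central, hs]
    · refine (hp (p.fst b)).2.congr fun u => ?_
      rw [p.central, hf]

theorem mul_hom_apply (f g : A →⋆ₙₐ[ℂ] A) (a : A) : (f * g) a = f (g a) := rfl

theorem map_corner (n : ℕ) {a : A} (ha : a ∈ corner α n) : α a ∈ corner α (n + 1) := by
  refine ⟨?_, ?_⟩
  · simpa only [Function.comp_def, map_mul, pow_succ', mul_hom_apply] using
      ((map_continuous α).tendsto a).comp ha.1
  · simpa only [Function.comp_def, map_mul, pow_succ', mul_hom_apply] using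
      ((map_continuous α).tendsto a).comp ha.2

theorem corner_succ_le (n : ℕ) : corner α (n + 1) ≤ corner α n := by
  intro a ha
  have hl := unitFilter_spec A
  refine ⟨?_, ?_⟩
  · refine (isClosed_tendsto (fun u a => (α ^ n) u * a) (norm_pow_mul_sub_le α n)).mem_of_tendsto
      ha.1 (Eventually.of_forall fun v => ?_)
    have h := (((map_continuous (α ^ n)).tendsto (α v)).comp (hl.2.2.2.1 (α v))).mul_const a
    simpa only [Function.comp_def, map_mul, pow_succ, mul_assoc, Set.mem_ofPred_eq,
      mul_hom_apply] using h
  · refine (isClosed_tendsto (fun u a => a * (α ^ n) u) (norm_mul_pow_sub_le α n)).mem_of_tendsto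
      ha.2 (Eventually.of_forall fun v => ?_)
    have h := (((map_continuous (α ^ n)).tendsto (α v)).comp (hl.2.2.2.2 (α v))).const_mul a
    simpa only [Function.comp_def, map_mul, pow_succ, mul_assoc, Set.mem_ofPred_eq,
      mul_hom_apply] using h

theorem mem_corner_zero (a : A) : a ∈ corner α 0 :=
  ⟨(unitFilter_spec A).2.2.2.1 a, (unitFilter_spec A).2.2.2.2 a⟩

/-! ### The natural reversible extension -/

variable (J : ClosedIdeal A)

/-- The algebra `B_n = q(A_0) ⊕ ⋯ ⊕ q(A_{n-1}) ⊕ A_n`, where `A_k` is the `k`-th corner and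
`q : A → A / J` is the quotient map. -/
def stage (n : ℕ) : NonUnitalStarSubalgebra ℂ ((Fin n → J.Quotient) × A) where
  carrier := {x | (∀ k : Fin n, x.1 k ∈ (corner α k).map J.proj) ∧ x.2 ∈ corner α n}
  mul_mem' hx hy := ⟨fun k => mul_mem (hx.1 k) (hy.1 k), mul_mem hx.2 hy.2⟩
  add_mem' hx hy := ⟨fun k => add_mem (hx.1 k) (hy.1 k), add_mem hx.2 hy.2⟩
  zero_mem' := ⟨fun _ => zero_mem _, zero_mem _⟩
  smul_mem' c _ hx := ⟨fun k => SMulMemClass.smul_mem c (hx.1 k), SMulMemClass.smul_mem c hx.2⟩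
  star_mem' hx := ⟨fun k => star_mem (hx.1 k), star_mem hx.2⟩

instance (n : ℕ) : IsClosed (stage α J n : Set ((Fin n → J.Quotient) × A)) := by
  have h1 : ∀ k : Fin n, IsClosed {x : (Fin n → J.Quotient) × A |
      x.1 k ∈ (corner α k).map J.proj} := fun k =>
    (ClosedIdeal.isClosed_map J.proj (corner α k) inferInstance).preimage
      ((continuous_apply k).comp continuous_fst)
  have h2 : IsClosed {x : (Fin n → J.Quotient) × A | x.2 ∈ corner α n} :=
    (inferInstance : IsClosed (corner α n : Set A)).preimage continuous_snd
  have h3 := (isClosed_iInter h1).inter h2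
  convert h3 using 1
  ext x
  simp only [Set.mem_inter_iff, Set.mem_iInter, Set.mem_ofPred_eq]
  rfl

/-- `a_0 ⊕ ⋯ ⊕ a_{n-1} ⊕ a_n ↦ a_0 ⊕ ⋯ ⊕ a_{n-1} ⊕ q(a_n) ⊕ α(a_n)`. -/
def snocHom (n : ℕ) : ((Fin n → J.Quotient) × A) →⋆ₙₐ[ℂ] ((Fin (n + 1) → J.Quotient) × A) where
  toFun x := (Fin.snoc (α := fun _ => J.Quotient) x.1 (J.proj x.2), α x.2)
  map_smul' c x := Prod.ext (funext fun k => by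
    refine Fin.lastCases ?_ (fun k => ?_) k <;> simp) (map_smul α c x.2)
  map_zero' := Prod.ext (funext fun k => by
    refine Fin.lastCases ?_ (fun k => ?_) k <;> simp) (map_zero α)
  map_add' x y := Prod.ext (funext fun k => by
    refine Fin.lastCases ?_ (fun k => ?_) k <;> simp) (map_add α x.2 y.2)
  map_mul' x y := Prod.ext (funext fun k => by
    refine Fin.lastCases ?_ (fun k => ?_) k
    · simpa using J.proj_mul x.2 y.2
    · simp) (map_mul α x.2 y.2)
  map_star' x := Prod.ext (funext fun k => by
    refine Fin.lastCases ?_ (fun k => ?_) k <;> simp [map_star]) (map_star α x.2)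

/-- `a_0 ⊕ a_1 ⊕ ⋯ ⊕ a_n ⊕ a ↦ a_1 ⊕ ⋯ ⊕ a_n ⊕ a`. -/
def tailHom (n : ℕ) : ((Fin (n + 1) → J.Quotient) × A) →⋆ₙₐ[ℂ] ((Fin n → J.Quotient) × A) where
  toFun x := (fun k => x.1 k.succ, x.2)
  map_smul' _ _ := rfl
  map_zero' := rfl
  map_add' _ _ := rfl
  map_mul' _ _ := rfl
  map_star' _ := rfl

theorem snocHom_mem (n : ℕ) {x} (hx : x ∈ stage α J n) : snocHom α J n x ∈ stage α J (n + 1) := by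
  refine ⟨fun k => ?_, map_corner α n hx.2⟩
  refine Fin.lastCases ?_ (fun k => ?_) k
  · have : (snocHom α J n x).1 (Fin.last n) = J.proj x.2 :=
      Fin.snoc_last (α := fun _ => J.Quotient) _ _
    rw [this]
    exact ⟨x.2, hx.2, rfl⟩
  · have : (snocHom α J n x).1 k.castSucc = x.1 k :=
      Fin.snoc_castSucc (α := fun _ => J.Quotient) _ _ _
    rw [this]
    exact hx.1 k

theorem tailHom_mem (n : ℕ) {x} (hx : x ∈ stage α J (n + 1)) : tailHom J n x ∈ stage α J n := by
  refine ⟨fun k => ?_, corner_succ_le α n hx.2⟩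
  obtain ⟨a, ha, h⟩ := hx.1 k.succ
  exact ⟨a, corner_succ_le α k ha, h⟩

theorem snocHom_tailHom (n : ℕ) (x) :
    snocHom α J n (tailHom J n x) = tailHom J (n + 1) (snocHom α J (n + 1) x) := by
  refine Prod.ext (funext fun k => ?_) rfl
  refine Fin.lastCases ?_ (fun k => ?_) k
  · change Fin.snoc (α := fun _ => J.Quotient) _ _ (Fin.last n) =
      Fin.snoc (α := fun _ => J.Quotient) _ _ (Fin.last n).succ
    rw [Fin.snoc_last, Fin.succ_last, Fin.snoc_last]
    rfl
  · change Fin.snoc (α := fun _ => J.Quotient) _ _ k.castSucc =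
      Fin.snoc (α := fun _ => J.Quotient) _ _ k.castSucc.succ
    rw [Fin.snoc_castSucc, Fin.succ_castSucc, Fin.snoc_castSucc]
    rfl

/-- The underlying type of `B_n`. -/
def Stage (n : ℕ) : Type _ := stage α J n

instance (n : ℕ) : NonUnitalCStarAlgebra (Stage α J n) :=
  inferInstanceAs (NonUnitalCStarAlgebra (stage α J n))

/-- The inclusion of `B_n` into `(A / J)^n ⊕ A`. -/
def stageIncl (n : ℕ) : Stage α J n →⋆ₙₐ[ℂ] ((Fin n → J.Quotient) × A) :=
  NonUnitalStarSubalgebraClass.subtype (stage α J n)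

/-- The bonding map `B_n → B_{n+1}`,
`a_0 ⊕ ⋯ ⊕ a_{n-1} ⊕ a_n ↦ a_0 ⊕ ⋯ ⊕ a_{n-1} ⊕ q(a_n) ⊕ α(a_n)`. -/
def bond (n : ℕ) : Stage α J n →⋆ₙₐ[ℂ] Stage α J (n + 1) :=
  NonUnitalStarAlgHom.codRestrict
    ((snocHom α J n).comp (stageIncl α J n))
    (stage α J (n + 1)) fun x => snocHom_mem α J n x.2

/-- The endomorphism `a_0 ⊕ a_1 ⊕ ⋯ ⊕ a_n ↦ a_1 ⊕ ⋯ ⊕ a_{n-1} ⊕ q(a_n) ⊕ α(a_n)` of `B_n`. -/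
def stageEndo (n : ℕ) : Stage α J n →⋆ₙₐ[ℂ] Stage α J n :=
  NonUnitalStarAlgHom.codRestrict
    ((tailHom J n).comp ((snocHom α J n).comp (stageIncl α J n)))
    (stage α J n) fun x => tailHom_mem α J n (snocHom_mem α J n x.2)

theorem bond_stageEndo (n : ℕ) (x : Stage α J n) :
    bond α J n (stageEndo α J n x) = stageEndo α J (n + 1) (bond α J n x) :=
  Subtype.ext (snocHom_tailHom α J n (snocHom α J n (stageIncl α J n x)))

/-- The algebra `B` of the natural reversible `J`-extension `(B, β)` of `(A, α)`: the direct limit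
of the sequence `B_0 → B_1 → B_2 → ⋯`. -/
abbrev NatExt : Type _ := Limit (bond α J)

/-- The endomorphism `β` of the natural reversible `J`-extension. -/
def natExtEndo : NatExt α J →⋆ₙₐ[ℂ] NatExt α J :=
  Limit.endo (stageEndo α J) (bond_stageEndo α J)

/-- The canonical identification of `A` with `B_0`. -/
def toStageZero : A →⋆ₙₐ[ℂ] Stage α J 0 where
  toFun a := ⟨(Fin.elim0, a), fun k => k.elim0, mem_corner_zero α a⟩
  map_smul' _ _ := Subtype.ext (Prod.ext (Subsingleton.elim _ _) rfl)
  map_zero' := Subtype.ext (Prod.ext (Subsingleton.elim _ _) rfl)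
  map_add' _ _ := Subtype.ext (Prod.ext (Subsingleton.elim _ _) rfl)
  map_mul' _ _ := Subtype.ext (Prod.ext (Subsingleton.elim _ _) rfl)
  map_star' _ := Subtype.ext (Prod.ext (Subsingleton.elim _ _) rfl)

/-- The canonical embedding of `A` into its natural reversible `J`-extension. -/
def natExtEmb : A →⋆ₙₐ[ℂ] NatExt α J := (Limit.ofZero (bond α J)).comp (toStageZero α J)

/-- If `A` is commutative, then so is its natural reversible `J`-extension. -/
theorem natExt_mul_comm (h : ∀ a b : A, a * b = b * a) (x y : NatExt α J) : x * y = y * x := by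
  have h1 : ∀ p q : J.Quotient, p * q = q * p := fun p q => by
    obtain ⟨a, rfl⟩ := J.proj_surjective p
    obtain ⟨b, rfl⟩ := J.proj_surjective q
    rw [← J.proj_mul, ← J.proj_mul, h]
  have h2 : ∀ n (p q : Stage α J n), p * q = q * p := fun n p q =>
    Subtype.ext (Prod.ext (funext fun k => h1 (p.1.1 k) (q.1.1 k)) (h p.1.2 q.1.2))
  refine Subtype.ext ?_
  obtain ⟨a, ha⟩ := (nullIdeal (Stage α J)).proj_surjective x.1
  obtain ⟨b, hb⟩ := (nullIdeal (Stage α J)).proj_surjective y.1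
  change x.1 * y.1 = y.1 * x.1
  rw [← ha, ← hb, ← ClosedIdeal.proj_mul, ← ClosedIdeal.proj_mul]
  exact congrArg _ (lp.ext (funext fun n => h2 n (a n) (b n)))

end System

/-! ### The space of backward orbits -/

section Orbits

variable {X : Type*} [TopologicalSpace X] {Δ : Set X} (φ : Δ → X) (Y : Set X)

/-- The set `X_N` of sequences `(x_0, …, x_N, 0, 0, …)` with `x_n ∈ Δ` and `φ(x_n) = x_{n-1}` for
`1 ≤ n ≤ N`, and with `x_N ∈ Y`. The extra isolated point `0` is `Sum.inr ()`. -/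
def finiteOrbits (N : ℕ) : Set (ℕ → X ⊕ Unit) :=
  {s | ∃ x : ℕ → X, (∀ n ≤ N, s n = Sum.inl (x n)) ∧ (∀ n, N < n → s n = Sum.inr ()) ∧
    (∀ n < N, ∃ h : x (n + 1) ∈ Δ, φ ⟨x (n + 1), h⟩ = x n) ∧ x N ∈ Y}

/-- The set `X_∞` of sequences `(x_0, x_1, …)` with `x_n ∈ Δ` and `φ(x_n) = x_{n-1}` for
`1 ≤ n`. -/
def infiniteOrbits : Set (ℕ → X ⊕ Unit) :=
  {s | ∃ x : ℕ → X, (∀ n, s n = Sum.inl (x n)) ∧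
    ∀ n, ∃ h : x (n + 1) ∈ Δ, φ ⟨x (n + 1), h⟩ = x n}

/-- The space of finite and infinite backward orbits, as a subspace of the product
`∏ n, (X ⊔ {0})`. -/
def orbitSpace : Set (ℕ → X ⊕ Unit) := (⋃ N, finiteOrbits φ Y N) ∪ infiniteOrbits φ

end Orbits

end CStarDyn
end

noncomputable section

namespace CStarDyn

/-! ### Characters of commutative C⋆-algebras -/

section Gelfand

open WeakDual WeakDual.CharacterSpace

variable {B : Type*} [NonUnitalCommCStarAlgebra B]

/-! An element `a_0 ⊕ ⋯ ⊕ a_n` of the stage `B_n` is read as a function on the orbit space. At an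
orbit whose last nonzero entry is `x_k` with `k < n`, its value is `a_k(x_k)`, which makes sense for
a class modulo `J` because `x_k ∈ Y`; at an orbit that reaches index `n`, its value is `a_n(x_n)`.
The bonding maps preserve this function: if the orbit stops at `x_n`, then `x_n ∈ Y` and `q(a_n)`
has the same value there as `a_n`; otherwise `α(a_n)(x_{n+1}) = a_n(φ(x_{n+1})) = a_n(x_n)`
(`IsDual.stageValue_snocHom`). Hence there is a ⋆-homomorphism `Γ` from `B` to functions on the
orbit space.

`Γ` is injective: orthogonality of `J` to `ker α` means that `Y` and the image of `φ` cover `X`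
(`IsDual.mem_or_exists_extendMap_eq`), so every point starts a backward orbit and there are enough
orbits to detect each summand of a stage (`IsDual.stageHom_injective`). The stage maps are then
isometric, and injectivity passes to the limit.

`Γ` takes values in functions vanishing at infinity: extendibility makes `Δ` clopen, so `φ` extends
continuously to `X ⊔ {0}`; moreover `φ` is proper. Therefore an ultrafilter of orbits converges once
a single coordinate converges in `X` (`IsDual.exists_orbit_le_nhds`).

The image of `Γ` separates points and vanishes nowhere, so evaluation identifies the orbit space
with the spectrum (`exists_characterSpace_homeomorph`). As for `β`, the map `β_n` is the bonding map
followed by deletion of the first summand. Deleting it amounts to evaluating at the orbit with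
`φ(x_0)` put in front; if `x_0 ∉ Δ`, the summands that remain come from corners whose elements
vanish at the points in question. -/

theorem isInducing_characterSpace_coe {B : Type*} [NonUnitalCStarAlgebra B] :
    IsInducing (fun (χ : characterSpace ℂ B) (b : B) => χ b) :=
  (show IsInducing (fun (χ : WeakDual ℂ B) (b : B) => χ b) from ⟨rfl⟩).comp .subtypeVal

/-- The extension of a character to the unitization. -/
def unitizationCharacter (f : B →ₙₐ[ℂ] ℂ) : characterSpace ℂ (Unitization ℂ B) :=
  equivAlgHom.symm (Unitization.lift f)

theorem unitizationCharacter_apply (f : B →ₙₐ[ℂ] ℂ) (u : Unitization ℂ B) :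
    unitizationCharacter f u = u.fst + f u.snd := rfl

/-- Elements of a commutative C⋆-algebra separate characters from closed sets of characters. -/
theorem exists_character_ne_zero_of_isClosed {Z : Set (characterSpace ℂ B)} (hZ : IsClosed Z)
    {χ : characterSpace ℂ B} (hχ : χ ∉ Z) : ∃ b, χ b ≠ 0 ∧ ∀ ψ ∈ Z, ψ b = 0 := by
  obtain ⟨C, hC, rfl⟩ := isInducing_characterSpace_coe.isClosed_iff.1 hZ
  let e : characterSpace ℂ (Unitization ℂ B) → B → ℂ := fun ω b => ω (b : Unitization ℂ B)
  have he : Continuous e := continuous_pi fun b =>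
    (WeakDual.eval_continuous (𝕜 := ℂ) (b : Unitization ℂ B)).comp continuous_subtype_val
  have hext : ∀ (ψ : characterSpace ℂ B) b,
      e (unitizationCharacter (toNonUnitalAlgHom ψ)) b = ψ b := fun ψ b => by
    simp [e, unitizationCharacter_apply]
  -- `unitizationCharacter 0` is the point at infinity. Adding it to the closed set forces the
  -- Urysohn function to come from an element of `B` rather than of its unitization.
  have hW : IsClosed (e ⁻¹' C ∪ {unitizationCharacter 0}) :=
    (hC.preimage he).union isClosed_singleton
  have hχW : unitizationCharacter (toNonUnitalAlgHom χ) ∉ e ⁻¹' C ∪ {unitizationCharacter 0} := by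
    rintro (h | h)
    · rw [Set.mem_preimage, funext (hext χ)] at h
      exact hχ h
    · refine χ.2.1 (ContinuousLinearMap.ext fun b => ?_)
      have h1 := hext χ b
      rw [Set.mem_singleton_iff.1 h] at h1
      have h2 : χ b = 0 := by simpa [e, unitizationCharacter_apply] using h1.symm
      exact h2
  obtain ⟨f, hf0, hf1, -⟩ := exists_continuous_zero_one_of_isClosed hW
    (isClosed_singleton (x := unitizationCharacter (toNonUnitalAlgHom χ)))
    (Set.disjoint_singleton_right.2 hχW)
  obtain ⟨u, hu⟩ := (gelfandStarTransform (Unitization ℂ B)).surjective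
    ⟨fun ω => (f ω : ℂ), by fun_prop⟩
  have hu' : ∀ ω : characterSpace ℂ (Unitization ℂ B), ω u = f ω := fun ω =>
    congrArg (fun g : C(characterSpace ℂ (Unitization ℂ B), ℂ) => g ω) hu
  have hu0 : u.fst = 0 := by
    have h := hu' (unitizationCharacter 0)
    rw [hf0 (Or.inr rfl)] at h
    simpa [unitizationCharacter_apply] using h
  have hus : u = (u.snd : Unitization ℂ B) := Unitization.ext hu0 rfl
  refine ⟨u.snd, ?_, fun ψ hψ => ?_⟩
  · have h := hu' (unitizationCharacter (toNonUnitalAlgHom χ))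
    rw [hf1 rfl] at h
    simp only [unitizationCharacter_apply, hu0, zero_add, Pi.one_apply, Complex.ofReal_one] at h
    exact h.symm ▸ one_ne_zero
  · have h := hu' (unitizationCharacter (toNonUnitalAlgHom ψ))
    rw [hf0 (Or.inl (by rwa [Set.mem_preimage, funext (hext ψ)]))] at h
    simpa [unitizationCharacter_apply, hu0] using h

/-- If a C⋆-algebra embeds into `C₀(Z)` as a subalgebra that separates the points of
`Z` and does not vanish at any of them, then its character space is `Z`. -/
theorem exists_characterSpace_homeomorph {B : Type*} [NonUnitalCStarAlgebra B] {Z : Type*}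
    [TopologicalSpace Z]
    (Γ : B →⋆ₙₐ[ℂ] C₀(Z, ℂ)) (hΓ : Function.Injective Γ) (h0 : ∀ z, ∃ b, Γ b z ≠ 0)
    (hs : ∀ z w, z ≠ w → ∃ b, Γ b z ≠ Γ b w) :
    ∃ h : characterSpace ℂ B ≃ₜ Z, ∀ z b, h.symm z b = Γ b z := by
  let _ : NonUnitalCommCStarAlgebra B :=
    { (inferInstance : NonUnitalCStarAlgebra B) with
      mul_comm := fun a b => hΓ (by rw [map_mul, map_mul, mul_comm]) }
  let ev : Z → characterSpace ℂ B := fun z =>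
    ⟨{ toFun := fun b => Γ b z
       map_add' := fun a b => by simp
       map_smul' := fun c b => by simp
       cont := (continuous_eval_const (F := BoundedContinuousFunction Z ℂ) z).comp
        (ZeroAtInftyContinuousMap.isometry_toBCF.continuous.comp (map_continuous Γ)) }, by
      obtain ⟨b, hb⟩ := h0 z
      exact fun h => hb (congrArg (fun f : WeakDual ℂ B => f b) h), fun a b => by
        change Γ (a * b) z = Γ a z * Γ b z
        simp⟩
  have hev : ∀ z b, ev z b = Γ b z := fun _ _ => rfl
  have hcont : Continuous ev := isInducing_characterSpace_coe.continuous_iff.2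
    (continuous_pi fun b => map_continuous (Γ b))
  have hinj : Function.Injective ev := fun z w h => by
    by_contra hzw
    obtain ⟨b, hb⟩ := hs z w hzw
    exact hb (by rw [← hev, h, hev])
  -- A limit `χ` in the character space is nonzero at some `b`. An ultrafilter escaping to infinity
  -- would give `χ b = 0`, since `Γ b` vanishes at infinity; so it contains a compact set and
  -- converges.
  have hproper : IsProperMap ev := by
    refine isProperMap_iff_ultrafilter_of_t2.2 ⟨hcont, fun 𝒰 χ h𝒰 => ?_⟩
    obtain ⟨b, hb⟩ : ∃ b, χ b ≠ 0 := by
      by_contra! h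
      exact χ.2.1 (ContinuousLinearMap.ext h)
    have h1 : Tendsto (fun z => Γ b z) 𝒰 (𝓝 (χ b)) :=
      ((continuous_apply b).comp isInducing_characterSpace_coe.continuous).continuousAt.tendsto.comp
        h𝒰
    have h2 : ¬ (𝒰 : Filter Z) ≤ cocompact Z := fun h =>
      hb (tendsto_nhds_unique h1 ((zero_at_infty (Γ b)).mono_left h))
    obtain ⟨S, hS, hS𝒰⟩ := Filter.not_le.1 h2
    obtain ⟨K, hK, hKS⟩ := mem_cocompact.1 hS
    have hK𝒰 : K ∈ 𝒰 := by
      by_contra h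
      exact hS𝒰 (mem_of_superset (Ultrafilter.compl_mem_iff_notMem.2 h) hKS)
    obtain ⟨z, -, hz⟩ := hK.ultrafilter_le_nhds 𝒰 (le_principal_iff.2 hK𝒰)
    exact ⟨z, hz⟩
  -- The range is closed by properness. A character outside it would be nonzero at some `b` that is
  -- killed by all evaluations, that is, with `Γ b = 0`.
  have hsurj : Function.Surjective ev := fun χ => by
    by_contra hχ
    obtain ⟨b, hb, hb'⟩ :=
      exists_character_ne_zero_of_isClosed hproper.isClosedMap.isClosed_range hχ
    have h : b = 0 := hΓ (by
      ext z
      rw [map_zero, ← hev]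
      exact hb' _ ⟨z, rfl⟩)
    exact hb (by rw [h, map_zero])
  let e := Equiv.ofBijective ev ⟨hinj, hsurj⟩
  let h : Z ≃ₜ characterSpace ℂ B := e.toHomeomorphOfContinuousClosed hcont hproper.isClosedMap
  exact ⟨h.symm, fun z b => rfl⟩

end Gelfand

/-! ### Maps out of direct limits -/

section LimitLift

variable {E : ℕ → Type*} [∀ n, NonUnitalCStarAlgebra (E n)] {T : ∀ n, E n →⋆ₙₐ[ℂ] E (n + 1)}
  {C : Type*} [NonUnitalCStarAlgebra C] (f : ∀ n, E n →⋆ₙₐ[ℂ] C)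

theorem dist_map_le (x y : lp E ∞) (n : ℕ) : dist (f n (x n)) (f n (y n)) ≤ ‖x - y‖ := by
  rw [dist_eq_norm, ← map_sub]
  exact (NonUnitalStarAlgHom.norm_apply_le (f n) _).trans
    (lp.norm_apply_le_norm ENNReal.top_ne_zero (x - y) n)

/-- An `ε / 3` argument: the maps `f n` are contractive, so the estimate is uniform in `n`. -/
theorem cauchySeq_map_of_mem_closure {S : Set (lp E ∞)}
    (hS : ∀ x ∈ S, CauchySeq fun n => f n (x n)) {x : lp E ∞} (hx : x ∈ closure S) :
    CauchySeq fun n => f n (x n) := by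
  rw [Metric.cauchySeq_iff']
  intro ε hε
  obtain ⟨y, hy, hxy⟩ := Metric.mem_closure_iff.1 hx (ε / 3) (by positivity)
  obtain ⟨N, hN⟩ := Metric.cauchySeq_iff'.1 (hS y hy) (ε / 3) (by positivity)
  rw [dist_eq_norm] at hxy
  refine ⟨N, fun n hn => ?_⟩
  have h1 := dist_map_le f x y n
  have h2 := dist_map_le f x y N
  have h3 := hN n hn
  have h4 := dist_triangle4 (f n (x n)) (f n (y n)) (f N (y N)) (f N (x N))
  rw [dist_comm (f N (y N))] at h4
  linarith

theorem tendsto_map_of_mem_nullIdeal {x : lp E ∞} (hx : x ∈ nullIdeal E) :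
    Tendsto (fun n => f n (x n)) atTop (𝓝 0) :=
  squeeze_zero_norm (fun n => NonUnitalStarAlgHom.norm_apply_le (f n) (x n)) hx

/-- Along an eventually coherent sequence the values `f n (y n)` are eventually constant, and a null
perturbation changes them by a null sequence; the rest is closure. -/
theorem cauchySeq_map_of_proj_mem (hf : ∀ n x, f (n + 1) (T n x) = f n x) {x : lp E ∞}
    (hx : (nullIdeal E).proj x ∈ limitSubalgebra T) : CauchySeq fun n => f n (x n) := by
  refine cauchySeq_map_of_mem_closure f
    (S := (nullIdeal E).proj ⁻¹' ((coherent T).map (nullIdeal E).proj)) ?_ ?_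
  · rintro x ⟨y, ⟨N, hN⟩, hxy⟩
    have h1 : Tendsto (fun n => f n (y n)) atTop (𝓝 (f N (y N))) := by
      refine tendsto_const_nhds.congr' ?_
      filter_upwards [eventually_ge_atTop N] with n hn
      induction n, hn using Nat.le_induction with
      | base => rfl
      | succ n hn ih => rw [hN n hn, hf, ih]
    have h2 := tendsto_map_of_mem_nullIdeal f ((nullIdeal E).proj_eq.1 hxy)
    refine Tendsto.cauchySeq (x := f N (y N) - 0) ((h1.sub h2).congr fun n => ?_)
    rw [← map_sub]
    exact congrArg (f n) (sub_sub_cancel (y n) (x n))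
  -- The limit is a closure taken in the quotient. Since the quotient map is open, the preimage of
  -- that closure is the closure of the preimage.
  · have ho : IsOpenMap (nullIdeal E).proj :=
      QuotientAddGroup.isOpenMap_coe (N := (nullIdeal E).sub.toAddSubgroup)
    rw [← ho.preimage_closure_eq_closure_preimage (map_continuous (nullIdeal E).proj)]
    exact hx

/-- The value at `b` of the map induced on the direct limit. -/
theorem Limit.exists_lift_value (hf : ∀ n x, f (n + 1) (T n x) = f n x) (b : Limit T) :
    ∃ c, ∀ x : lp E ∞, (nullIdeal E).proj x = Limit.incl T b →
      Tendsto (fun n => f n (x n)) atTop (𝓝 c) := by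
  obtain ⟨x, hx⟩ := (nullIdeal E).proj_surjective (Limit.incl T b)
  obtain ⟨c, hc⟩ := cauchySeq_tendsto_of_complete
    (cauchySeq_map_of_proj_mem f hf (x := x) (hx ▸ b.2))
  refine ⟨c, fun y hy => ?_⟩
  have h := tendsto_map_of_mem_nullIdeal f ((nullIdeal E).proj_eq.1 (hy.trans hx.symm))
  refine ((h.add hc).congr fun n => ?_).trans (by rw [zero_add])
  rw [← map_add]
  exact congrArg (f n) (sub_add_cancel (y n) (x n))

/-- The universal property of the direct limit: a compatible sequence of ⋆-homomorphisms induces a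
⋆-homomorphism on the limit. -/
theorem Limit.exists_lift (hf : ∀ n x, f (n + 1) (T n x) = f n x) :
    ∃ F : Limit T →⋆ₙₐ[ℂ] C, ∀ (b : Limit T) (x : lp E ∞),
      (nullIdeal E).proj x = Limit.incl T b → Tendsto (fun n => f n (x n)) atTop (𝓝 (F b)) := by
  choose F hF using Limit.exists_lift_value f hf
  -- Any representative computes `F b`, so the algebraic identities follow termwise from sums,
  -- products and adjoints of representatives.
  have key : ∀ (b : Limit T) (x : lp E ∞) c, (nullIdeal E).proj x = Limit.incl T b →
      Tendsto (fun n => f n (x n)) atTop (𝓝 c) → F b = c := fun b x c h h' =>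
    tendsto_nhds_unique (hF b x h) h'
  have rep : ∀ b : Limit T, ∃ x, (nullIdeal E).proj x = Limit.incl T b := fun b =>
    (nullIdeal E).proj_surjective _
  refine ⟨{
    toFun := F
    map_smul' := ?_
    map_zero' := ?_
    map_add' := ?_
    map_mul' := ?_
    map_star' := ?_ }, hF⟩
  · intro c a
    obtain ⟨x, hx⟩ := rep a
    refine key _ (c • x) _ (by rw [map_smul, map_smul, hx]) ?_
    exact ((hF a x hx).const_smul c).congr fun n => (map_smul (f n) c (x n)).symm
  · exact key _ 0 _ (by rw [map_zero, map_zero])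
      (tendsto_const_nhds.congr fun n => (map_zero (f n)).symm)
  · intro a b
    obtain ⟨x, hx⟩ := rep a
    obtain ⟨y, hy⟩ := rep b
    refine key _ (x + y) _ (by rw [map_add, map_add, hx, hy]) ?_
    exact ((hF a x hx).add (hF b y hy)).congr fun n => (map_add (f n) (x n) (y n)).symm
  · intro a b
    obtain ⟨x, hx⟩ := rep a
    obtain ⟨y, hy⟩ := rep b
    refine key _ (x * y) _ (by rw [map_mul, map_mul, hx, hy]) ?_
    exact ((hF a x hx).mul (hF b y hy)).congr fun n => (map_mul (f n) (x n) (y n)).symm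
  · intro a
    obtain ⟨x, hx⟩ := rep a
    refine key _ (star x) _ (by rw [map_star, map_star, hx]) ?_
    exact ((hF a x hx).star).congr fun n => (map_star (f n) (x n)).symm

/-- Injective ⋆-homomorphisms are isometric, so `F b = 0` makes every representative of `b` a null
sequence. -/
theorem Limit.injective_of_tendsto (hinj : ∀ n, Function.Injective (f n)) {F : Limit T →⋆ₙₐ[ℂ] C}
    (hF : ∀ (b : Limit T) (x : lp E ∞),
      (nullIdeal E).proj x = Limit.incl T b → Tendsto (fun n => f n (x n)) atTop (𝓝 (F b))) :
    Function.Injective F := by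
  rw [injective_iff_map_eq_zero]
  intro b hb
  obtain ⟨x, hx⟩ := (nullIdeal E).proj_surjective (Limit.incl T b)
  have h := (hF b x hx).norm
  rw [hb, norm_zero] at h
  have hx0 : x ∈ nullIdeal E := h.congr fun n => NonUnitalStarAlgHom.norm_map (f n) (hinj n) (x n)
  exact Subtype.ext (hx.symm.trans ((ClosedIdeal.proj_eq_zero _).2 hx0))

theorem Limit.apply_eq_of_coherent (hf : ∀ n x, f (n + 1) (T n x) = f n x) {F : Limit T →⋆ₙₐ[ℂ] C}
    (hF : ∀ (b : Limit T) (x : lp E ∞),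
      (nullIdeal E).proj x = Limit.incl T b → Tendsto (fun n => f n (x n)) atTop (𝓝 (F b)))
    {b : Limit T} {x : lp E ∞} (hx : (nullIdeal E).proj x = Limit.incl T b) {N : ℕ}
    (hN : ∀ n, N ≤ n → x (n + 1) = T n (x n)) : F b = f N (x N) := by
  refine tendsto_nhds_unique (hF b x hx) (tendsto_const_nhds.congr' ?_)
  filter_upwards [eventually_ge_atTop N] with n hn
  induction n, hn using Nat.le_induction with
  | base => rfl
  | succ n hn ih => rw [hN n hn, hf, ih]

/-- Every element of `E n` is the `n`-th term of a sequence that is coherent from `n` on. -/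
theorem exists_coherent (T : ∀ n, E n →⋆ₙₐ[ℂ] E (n + 1)) (N : ℕ) (z : E N) :
    ∃ x : lp E ∞, x N = z ∧ ∀ n, N ≤ n → x (n + 1) = T n (x n) := by
  classical
  -- The sequence is `0` before index `N`, is reset to `z` at `N`, and follows the bonding maps
  -- afterwards. The casts only transport `z` along the equality of indices.
  let x : ∀ n, E n := fun n => Nat.rec (motive := E)
    (if h : N = 0 then cast (congrArg E h) z else 0)
    (fun n y => if h : N = n + 1 then cast (congrArg E h) z else T n y) n
  have hsucc : ∀ n, x (n + 1) =
    if h : N = n + 1 then cast (congrArg E h) z else T n (x n) := fun _ => rfl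
  have hzN : x N = z := by
    cases N with
    | zero => simp [x]
    | succ N => simp [hsucc]
  have hn : ∀ n, ‖x n‖ ≤ ‖z‖ := by
    intro n
    induction n with
    | zero =>
      by_cases h : N = 0
      · subst h
        exact hzN ▸ le_rfl
      · change ‖dite _ _ _‖ ≤ _
        simp [h]
    | succ n ih =>
      by_cases h : N = n + 1
      · subst h
        exact hzN ▸ le_rfl
      · rw [hsucc, dif_neg h]
        exact (NonUnitalStarAlgHom.norm_apply_le (T n) _).trans ih
  refine ⟨⟨x, memℓp_infty ⟨‖z‖, ?_⟩⟩, hzN, fun n h => ?_⟩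
  · rintro _ ⟨n, rfl⟩
    exact hn n
  · exact (hsucc n).trans (dif_neg (by omega))

/-- Carries separation of points from the stages to the limit. -/
theorem Limit.exists_apply_eq (hf : ∀ n x, f (n + 1) (T n x) = f n x) {F : Limit T →⋆ₙₐ[ℂ] C}
    (hF : ∀ (b : Limit T) (x : lp E ∞),
      (nullIdeal E).proj x = Limit.incl T b → Tendsto (fun n => f n (x n)) atTop (𝓝 (F b)))
    (n : ℕ) (z : E n) : ∃ b, F b = f n z := by
  obtain ⟨x, hx, hn⟩ := exists_coherent T n z
  refine ⟨⟨(nullIdeal E).proj x, NonUnitalStarSubalgebra.le_topologicalClosure _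
      ⟨x, ⟨n, hn⟩, rfl⟩⟩, ?_⟩
  exact (Limit.apply_eq_of_coherent f hf hF (x := x) rfl hn).trans (congrArg (f n) hx)

end LimitLift

/-! ### Partial maps dual to endomorphisms of `C₀(X)` -/

section PartialMap

variable {X : Type*} {Δ : Set X} {φ : Δ → X}

theorem exists_eq_inl_of_ne_inr {p : X ⊕ Unit} (h : p ≠ Sum.inr ()) : ∃ x, p = Sum.inl x := by
  cases p with
  | inl x => exact ⟨x, rfl⟩
  | inr u => exact absurd rfl h

open Classical in
/-- The extension of a partial map of `X` to a map of `X ⊔ {0}` that is `0` where the partial map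
is not defined. -/
def extendMap (φ : Δ → X) : X ⊕ Unit → X ⊕ Unit :=
  Sum.elim (fun x => if h : x ∈ Δ then Sum.inl (φ ⟨x, h⟩) else Sum.inr ()) fun _ => Sum.inr ()

theorem extendMap_of_mem {x : X} (h : x ∈ Δ) : extendMap φ (Sum.inl x) = Sum.inl (φ ⟨x, h⟩) :=
  dif_pos h

theorem extendMap_of_notMem {x : X} (h : x ∉ Δ) : extendMap φ (Sum.inl x) = Sum.inr () :=
  dif_neg h

@[simp]
theorem extendMap_inr (u : Unit) : extendMap φ (Sum.inr u) = Sum.inr () := rfl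

theorem extendMap_inl_eq_inl_iff {x y : X} :
    extendMap φ (Sum.inl x) = Sum.inl y ↔ ∃ h : x ∈ Δ, φ ⟨x, h⟩ = y := by
  by_cases h : x ∈ Δ
  · simp [extendMap_of_mem h, h]
  · simp [extendMap_of_notMem h, h]

theorem extendMap_ne_inr_iff {p : X ⊕ Unit} :
    extendMap φ p ≠ Sum.inr () ↔ ∃ x ∈ Δ, p = Sum.inl x := by
  rcases p with x | u
  · by_cases h : x ∈ Δ
    · simp [extendMap_of_mem h, h]
    · simp [extendMap_of_notMem h, h]
  · simp

variable [TopologicalSpace X]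

/-- Evaluation at a point of `X ⊔ {0}`; functions vanish at the extra point. -/
def pointEval (p : X ⊕ Unit) : C₀(X, ℂ) →⋆ₙₐ[ℂ] ℂ where
  toFun a := Sum.elim a 0 p
  map_smul' c a := by cases p <;> simp
  map_zero' := by cases p <;> simp
  map_add' a b := by cases p <;> simp
  map_mul' a b := by cases p <;> simp
  map_star' a := by cases p <;> simp

@[simp]
theorem pointEval_inl (x : X) (a : C₀(X, ℂ)) : pointEval (Sum.inl x) a = a x := rfl

@[simp]
theorem pointEval_inr (u : Unit) (a : C₀(X, ℂ)) : pointEval (Sum.inr u) a = 0 := rfl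

theorem continuous_pointEval (a : C₀(X, ℂ)) : Continuous fun p => pointEval p a :=
  (map_continuous a).sumElim continuous_const

/-- As `ε > 0`, the extra point is excluded, and what is left is a closed subset of the copy of a
compact set off which `a` is smaller than `ε`. -/
theorem isCompact_le_norm_pointEval (a : C₀(X, ℂ)) {ε : ℝ} (hε : 0 < ε) :
    IsCompact {p | ε ≤ ‖pointEval p a‖} := by
  obtain ⟨K, hK, hKa⟩ := mem_cocompact.1
    ((zero_at_infty a).norm.eventually (gt_mem_nhds (by simpa using hε)))
  refine (hK.image continuous_inl).of_isClosed_subset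
    (isClosed_le continuous_const (continuous_pointEval a).norm) ?_
  rintro (x | u) hp
  · refine ⟨x, ?_, rfl⟩
    by_contra hx
    exact (show ‖a x‖ < ε from hKa hx).not_ge (show ε ≤ ‖a x‖ from hp)
  · simp only [Set.mem_ofPred_eq, pointEval_inr, norm_zero] at hp
    exact absurd hp hε.not_ge

/-- Convergence of an ultrafilter along which an element of `C₀(X)` does not tend to zero. -/
theorem exists_le_nhds_of_tendsto_pointEval {𝒰 : Ultrafilter (X ⊕ Unit)} {a : C₀(X, ℂ)} {c : ℂ}
    (hc : c ≠ 0) (h : Tendsto (fun p => pointEval p a) 𝒰 (𝓝 c)) : ∃ p, 𝒰.1 ≤ 𝓝 p := by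
  have hpos : 0 < ‖c‖ := norm_pos_iff.2 hc
  have h1 := h.norm.eventually (lt_mem_nhds (half_lt_self hpos))
  obtain ⟨p, -, hp⟩ := (isCompact_le_norm_pointEval a (half_pos hpos)).ultrafilter_le_nhds 𝒰
    (le_principal_iff.2 (h1.mono fun p hp => hp.le))
  exact ⟨p, hp⟩

theorem isOpen_ne_inr : IsOpen {p : X ⊕ Unit | p ≠ Sum.inr ()} := by
  convert isOpen_range_inl (X := X) (Y := Unit)
  ext (x | u) <;> simp

theorem isClosed_ne_inr : IsClosed {p : X ⊕ Unit | p ≠ Sum.inr ()} := by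
  convert isClosed_range_inl (X := X) (Y := Unit)
  ext (x | u) <;> simp

/-- The partial map `φ : Δ → X` is dual to the endomorphism `α` of `C₀(X)`. -/
def IsDual (α : C₀(X, ℂ) →⋆ₙₐ[ℂ] C₀(X, ℂ)) (φ : Δ → X) : Prop :=
  ∀ (a : C₀(X, ℂ)) (x : X), (∀ hx : x ∈ Δ, α a x = a (φ ⟨x, hx⟩)) ∧ (x ∉ Δ → α a x = 0)

variable {α : C₀(X, ℂ) →⋆ₙₐ[ℂ] C₀(X, ℂ)}

theorem IsDual.pointEval_map (hφ : IsDual α φ) (p : X ⊕ Unit) (a : C₀(X, ℂ)) :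
    pointEval p (α a) = pointEval (extendMap φ p) a := by
  rcases p with x | u
  · by_cases h : x ∈ Δ
    · rw [extendMap_of_mem h]
      exact (hφ a x).1 h
    · rw [extendMap_of_notMem h]
      exact (hφ a x).2 h
  · rfl

theorem IsDual.pointEval_pow (hφ : IsDual α φ) (n : ℕ) (p : X ⊕ Unit) (a : C₀(X, ℂ)) :
    pointEval p ((α ^ n) a) = pointEval ((extendMap φ)^[n] p) a := by
  induction n generalizing p with
  | zero => rfl
  | succ n ih => rw [pow_succ', mul_hom_apply, hφ.pointEval_map, ih, Function.iterate_succ_apply]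

/-- Such an `a` is the limit of `(α ^ n) u * a`, and `(α ^ n) u` vanishes wherever the `n`-th
iterate of `φ` is undefined. -/
theorem IsDual.pointEval_eq_zero_of_mem_corner (hφ : IsDual α φ) {n : ℕ} {a : C₀(X, ℂ)}
    (ha : a ∈ corner α n) {p : X ⊕ Unit} (hp : (extendMap φ)^[n] p = Sum.inr ()) :
    pointEval p a = 0 := by
  have h := ((map_continuous (pointEval p)).tendsto a).comp ha.1
  simp only [Function.comp_def, map_mul, hφ.pointEval_pow, hp, pointEval_inr, zero_mul] at h
  exact tendsto_nhds_unique h tendsto_const_nhds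

/-- `(α ^ n) u * (α ^ n) g = (α ^ n) (u * g)` tends to `(α ^ n) g`; commutativity gives the other
side. This is the source of concrete corner elements. -/
theorem pow_apply_mul_mem_corner (α : C₀(X, ℂ) →⋆ₙₐ[ℂ] C₀(X, ℂ)) (n : ℕ) (g a : C₀(X, ℂ)) :
    (α ^ n) g * a ∈ corner α n := by
  have h := (((map_continuous (α ^ n)).tendsto g).comp
    ((unitFilter_spec C₀(X, ℂ)).2.2.2.1 g)).mul_const a
  simp only [Function.comp_def, map_mul] at h
  refine ⟨h.congr fun u => mul_assoc _ _ _, h.congr fun u => ?_⟩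
  rw [mul_assoc, mul_comm]

/-! ### Clopen domain, continuity and properness of the dual partial map. -/

variable [T2Space X] [LocallyCompactSpace X]

theorem exists_zeroAtInfty_bump (x : X) {U : Set X}
    (hU : U ∈ 𝓝 x) : ∃ a : C₀(X, ℂ), a x = 1 ∧ ∀ y ∉ U, a y = 0 := by
  obtain ⟨V, hVU, hV, hxV⟩ := mem_nhds_iff.1 hU
  obtain ⟨f, hf1, hf0, hfc, -⟩ := exists_continuous_one_zero_of_isCompact
    (isCompact_singleton (x := x)) hV.isClosed_compl (by simpa using hxV)
  have hc : HasCompactSupport fun y => (f y : ℂ) := hfc.comp_left (g := Complex.ofReal) rfl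
  refine ⟨⟨⟨fun y => (f y : ℂ), by fun_prop⟩, hc.is_zero_at_infty⟩, ?_, fun y hy => ?_⟩
  · change (f x : ℂ) = 1
    simp [hf1 rfl]
  · change (f y : ℂ) = 0
    simp [hf0 (show y ∈ Vᶜ from fun h => hy (hVU h))]

theorem tendsto_unitFilter_apply (x : X) :
    Tendsto (fun u : C₀(X, ℂ) => u x) (unitFilter C₀(X, ℂ)) (𝓝 1) := by
  obtain ⟨a, ha, -⟩ := exists_zeroAtInfty_bump x univ_mem
  have h := ((map_continuous (pointEval (Sum.inl x))).tendsto a).comp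
    ((unitFilter_spec C₀(X, ℂ)).2.2.2.1 a)
  simpa [Function.comp_def, ha] using h

/-- The strict limit `p` acts as multiplication by the indicator function of `Δ`. Continuity of `p
a`, for `a` equal to `1` at a given point, shows that the indicator is locally constant there. -/
theorem IsDual.isClopen (hφ : IsDual α φ) (hα : IsExtendible α) : IsClopen Δ := by
  obtain ⟨p, hp⟩ := hα
  have hlim : ∀ (a : C₀(X, ℂ)) x, Tendsto (fun u => α u x * a x) (unitFilter C₀(X, ℂ))
      (𝓝 (p.fst a x)) := fun a x =>
    ((map_continuous (pointEval (Sum.inl x))).tendsto (p.fst a)).comp (hp a).1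
  have hin : ∀ (a : C₀(X, ℂ)), ∀ x ∈ Δ, p.fst a x = a x := fun a x hx => by
    refine tendsto_nhds_unique (hlim a x) ?_
    simpa [(hφ _ x).1 hx] using (tendsto_unitFilter_apply (φ ⟨x, hx⟩)).mul_const (a x)
  have hout : ∀ (a : C₀(X, ℂ)), ∀ x ∉ Δ, p.fst a x = 0 := fun a x hx => by
    refine tendsto_nhds_unique (hlim a x) ?_
    simp [(hφ _ x).2 hx]
  constructor
  · rw [← isOpen_compl_iff, isOpen_iff_mem_nhds]
    intro x hx
    obtain ⟨a, ha, -⟩ := exists_zeroAtInfty_bump x univ_mem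
    have h : ∀ᶠ y in 𝓝 x, a y - p.fst a y ≠ 0 :=
      ((map_continuous a).sub (map_continuous (p.fst a))).continuousAt.eventually_ne (by
        simp [ha, hout a x hx])
    filter_upwards [h] with y hy hyΔ
    exact hy (by rw [hin a y hyΔ, sub_self])
  · rw [isOpen_iff_mem_nhds]
    intro x hx
    obtain ⟨a, ha, -⟩ := exists_zeroAtInfty_bump x univ_mem
    have h : ∀ᶠ y in 𝓝 x, p.fst a y ≠ 0 :=
      (map_continuous (p.fst a)).continuousAt.eventually_ne (by simp [ha, hin a x hx])
    filter_upwards [h] with y hy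
    by_contra hyΔ
    exact hy (hout a y hyΔ)

/-- Bumps detect the topology of `X`: if `a` is a bump at `φ(x)` inside a neighbourhood, then `α a ≠
0` near `x`, which places nearby points in `Δ` and their images in that neighbourhood. Off `Δ`,
closedness makes the extension locally constant. -/
theorem IsDual.continuous_extendMap (hφ : IsDual α φ) (hΔ : IsClosed Δ) :
    Continuous (extendMap φ) := by
  refine continuous_sum_dom.2 ⟨continuous_iff_continuousAt.2 fun x => ?_, continuous_const⟩
  by_cases hx : x ∈ Δ
  · intro V hV
    simp only [Function.comp_apply, extendMap_of_mem hx] at hV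
    obtain ⟨a, ha, ha0⟩ := exists_zeroAtInfty_bump (φ ⟨x, hx⟩) (continuous_inl.continuousAt hV)
    have h : ∀ᶠ y in 𝓝 x, α a y ≠ 0 :=
      (map_continuous (α a)).continuousAt.eventually_ne (by simp [(hφ a x).1 hx, ha])
    rw [mem_map]
    filter_upwards [h] with y hy
    by_cases hyΔ : y ∈ Δ
    · rw [(hφ a y).1 hyΔ] at hy
      simp only [Set.mem_preimage, Function.comp_apply, extendMap_of_mem hyΔ]
      by_contra hV'
      exact hy (ha0 _ hV')
    · exact absurd ((hφ a y).2 hyΔ) hy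
  · refine ContinuousAt.congr (f := fun _ => Sum.inr ()) continuousAt_const ?_
    filter_upwards [hΔ.isOpen_compl.mem_nhds hx] with y hy
    exact (extendMap_of_notMem hy).symm

/-- The partial map dual to an endomorphism is proper. -/
theorem IsDual.exists_le_nhds (hφ : IsDual α φ) {𝒰 : Ultrafilter (X ⊕ Unit)} {x : X}
    (h : Tendsto (extendMap φ) 𝒰 (𝓝 (Sum.inl x))) : ∃ p, 𝒰.1 ≤ 𝓝 p := by
  obtain ⟨a, ha, -⟩ := exists_zeroAtInfty_bump x univ_mem
  -- Along the ultrafilter `α a` tends to `a x = 1`, so the ultrafilter cannot escape to infinity.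
  refine exists_le_nhds_of_tendsto_pointEval (a := α a) (c := a x) (ha ▸ one_ne_zero) ?_
  simp only [hφ.pointEval_map]
  exact ((continuous_pointEval a).tendsto _).comp h

/-- An ultrafilter whose image tends to `x` converges by properness, and by continuity its limit is
a preimage of `x`. -/
theorem IsDual.mem_range_of_mem_closure (hφ : IsDual α φ) (hc : Continuous (extendMap φ)) {x : X}
    (hx : Sum.inl x ∈ closure (Set.range (extendMap φ))) : Sum.inl x ∈ Set.range (extendMap φ) := by
  have hne : (comap (extendMap φ) (𝓝 (Sum.inl x))).NeBot := by
    rw [comap_neBot_iff_frequently]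
    exact mem_closure_iff_frequently.1 hx
  have ht : Tendsto (extendMap φ) (Ultrafilter.of (comap (extendMap φ) (𝓝 (Sum.inl x))))
      (𝓝 (Sum.inl x)) := tendsto_iff_comap.2 (Ultrafilter.of_le _)
  obtain ⟨p, hp⟩ := hφ.exists_le_nhds ht
  exact ⟨p, tendsto_nhds_unique ((hc.tendsto p).mono_left hp) ht⟩

/-- If `J` is orthogonal to the kernel of `α`, then the hull of `J` and the image of the dual map
cover the space. -/
theorem IsDual.mem_or_exists_extendMap_eq (hφ : IsDual α φ) (hc : Continuous (extendMap φ))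
    {J : ClosedIdeal C₀(X, ℂ)} (hJ : ∀ a ∈ J, ∀ b, α b = 0 → a * b = 0) {Y : Set X}
    (hY : IsClosed Y) (hJY : ∀ a : C₀(X, ℂ), a ∈ J ↔ ∀ y ∈ Y, a y = 0) (x : X) :
    x ∈ Y ∨ ∃ p, extendMap φ p = Sum.inl x := by
  by_contra! h
  obtain ⟨hxY, hx⟩ := h
  -- Of two bumps at `x`, `a` vanishes on `Y`, so lies in `J`, while `b` vanishes on the image of
  -- `φ`, so lies in `ker α`. Their product is `1` at `x`, contradicting orthogonality.
  obtain ⟨a, ha, ha0⟩ := exists_zeroAtInfty_bump x (hY.isOpen_compl.mem_nhds hxY)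
  have hx' : Sum.inl x ∉ closure (Set.range (extendMap φ)) := fun h => by
    obtain ⟨p, hp⟩ := hφ.mem_range_of_mem_closure hc h
    exact hx p hp
  obtain ⟨b, hb, hb0⟩ := exists_zeroAtInfty_bump x
    (continuous_inl.continuousAt (isClosed_closure.isOpen_compl.mem_nhds hx'))
  have hαb : α b = 0 := by
    ext y
    rw [← pointEval_inl, hφ.pointEval_map]
    rcases hp : extendMap φ (Sum.inl y) with z | u
    · exact hb0 z fun hz => hz (hp ▸ subset_closure ⟨_, rfl⟩)
    · rfl
  have hab := hJ a ((hJY a).2 fun y hy => ha0 y fun h => h hy) b hαb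
  have : (a * b) x = 1 := by simp [ha, hb]
  simp [hab] at this

/-- Points where the `n`-th iterate of the dual map is defined are separated from all others by
elements of the `n`-th corner. -/
theorem IsDual.exists_mem_corner (hφ : IsDual α φ) {n : ℕ} {p q : X ⊕ Unit} (hpq : p ≠ q)
    (hp : (extendMap φ)^[n] p ≠ Sum.inr ()) :
    ∃ a ∈ corner α n, pointEval p a ≠ 0 ∧ pointEval q a = 0 := by
  obtain ⟨x, rfl⟩ : ∃ x, p = Sum.inl x := by
    refine exists_eq_inl_of_ne_inr ?_
    rintro rfl
    exact hp (Function.iterate_fixed (extendMap_inr _) n)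
  obtain ⟨y, hy⟩ := exists_eq_inl_of_ne_inr hp
  obtain ⟨g, hg, -⟩ := exists_zeroAtInfty_bump y univ_mem
  obtain ⟨a, ha, ha0⟩ := exists_zeroAtInfty_bump x
    (continuous_inl.continuousAt (isOpen_compl_singleton.mem_nhds hpq))
  -- The factor `(α ^ n) g` puts the product in the corner and is `1` at `p`; the factor `a`
  -- separates `p` from `q`.
  refine ⟨_, pow_apply_mul_mem_corner α n g a, ?_, ?_⟩
  · rw [map_mul, hφ.pointEval_pow, hy]
    simp [hg, ha]
  · rw [map_mul]
    rcases q with z | u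
    · rw [pointEval_inl z a, ha0 z fun h => h rfl, mul_zero]
    · simp

end PartialMap

/-! ### Backward orbits -/

section BackwardOrbits

variable {X : Type*} {Δ : Set X} {φ : Δ → X} {Y : Set X}

/-- The sequence `(φ(s_0), s_0, s_1, …)`. -/
def prependImage (φ : Δ → X) (s : ℕ → X ⊕ Unit) : ℕ → X ⊕ Unit
  | 0 => extendMap φ (s 0)
  | n + 1 => s n

/-- Membership becomes a condition on consecutive entries, with no case distinction between finite
and infinite orbits. In this form stability under shifting and prepending is immediate, and
closedness can be checked coordinatewise. -/
theorem mem_orbitSpace_iff {s : ℕ → X ⊕ Unit} : s ∈ orbitSpace φ Y ↔ s 0 ≠ Sum.inr () ∧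
    ∀ n, (s (n + 1) = Sum.inr () → s n = Sum.inr () ∨ s n ∈ Sum.inl '' Y) ∧
      (s (n + 1) ≠ Sum.inr () → s n ≠ Sum.inr () ∧ extendMap φ (s (n + 1)) = s n) := by
  constructor
  · rintro (hs | ⟨x, hx, hφx⟩)
    · obtain ⟨N, x, hx, h0, hφx, hY⟩ := Set.mem_iUnion.1 hs
      refine ⟨by simp [hx 0 N.zero_le], fun n => ?_⟩
      rcases lt_trichotomy n N with h | rfl | h
      · rw [hx n h.le, hx (n + 1) h]
        exact ⟨by simp, fun _ => ⟨by simp, extendMap_inl_eq_inl_iff.2 (hφx n h)⟩⟩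
      · rw [hx n le_rfl, h0 (n + 1) n.lt_succ_self]
        exact ⟨fun _ => Or.inr ⟨_, hY, rfl⟩, fun h => absurd rfl h⟩
      · rw [h0 n h, h0 (n + 1) (h.trans n.lt_succ_self)]
        exact ⟨fun _ => Or.inl rfl, fun h => absurd rfl h⟩
    · refine ⟨by simp [hx 0], fun n => ?_⟩
      rw [hx n, hx (n + 1)]
      exact ⟨by simp, fun _ => ⟨by simp, extendMap_inl_eq_inl_iff.2 (hφx n)⟩⟩
  · rintro ⟨h0, h⟩
    by_cases hs : ∃ n, s n = Sum.inr ()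
    · classical
      -- The first zero entry is not at index `0`, so it is at some `N + 1`, and `N` is the last
      -- index with an entry in `X`.
      obtain ⟨N, hN⟩ : ∃ N, Nat.find hs = N + 1 := Nat.exists_eq_succ_of_ne_zero fun h1 =>
        h0 (h1 ▸ Nat.find_spec hs)
      have hN1 : s (N + 1) = Sum.inr () := hN ▸ Nat.find_spec hs
      have hne : ∀ n ≤ N, s n ≠ Sum.inr () := fun n hn => Nat.find_min hs (by omega)
      have hsN := hne N le_rfl
      obtain ⟨x₀, hx₀⟩ := exists_eq_inl_of_ne_inr hsN
      -- Beyond `N` the point `x n` is a dummy; `finiteOrbits` constrains it only up to `N`.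
      have hex : ∀ n, ∃ x, n ≤ N → s n = Sum.inl x := fun n => by
        by_cases hn : n ≤ N
        · obtain ⟨x, hx⟩ := exists_eq_inl_of_ne_inr (hne n hn)
          exact ⟨x, fun _ => hx⟩
        · exact ⟨x₀, fun h => absurd h hn⟩
      choose x hx using hex
      refine Or.inl (Set.mem_iUnion.2 ⟨N, x, hx, fun n hn => ?_, fun n hn => ?_, ?_⟩)
      · induction n, hn using Nat.le_induction with
        | base => exact hN1
        | succ n hn ih =>
          by_contra hc
          exact ((h n).2 hc).1 ih
      · have h1 := ((h n).2 (hne (n + 1) hn)).2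
        rw [hx n hn.le, hx (n + 1) hn] at h1
        exact extendMap_inl_eq_inl_iff.1 h1
      · obtain h1 | ⟨y, hy, hy'⟩ := (h N).1 hN1
        · exact absurd h1 hsN
        · rw [hx N le_rfl] at hy'
          exact Sum.inl_injective hy' ▸ hy
    · push Not at hs
      choose x hx using fun n => exists_eq_inl_of_ne_inr (hs n)
      refine Or.inr ⟨x, hx, fun n => ?_⟩
      have h1 := ((h n).2 (hs (n + 1))).2
      rw [hx n, hx (n + 1)] at h1
      exact extendMap_inl_eq_inl_iff.1 h1

theorem ne_inr_of_le {s : ℕ → X ⊕ Unit} (hs : s ∈ orbitSpace φ Y) {m n : ℕ} (hmn : m ≤ n)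
    (hn : s n ≠ Sum.inr ()) : s m ≠ Sum.inr () := by
  induction n, hmn using Nat.le_induction with
  | base => exact hn
  | succ n hmn ih => exact ih (((mem_orbitSpace_iff.1 hs).2 n).2 hn).1

theorem exists_last_of_eq_inr {s : ℕ → X ⊕ Unit} (hs : s ∈ orbitSpace φ Y) {n : ℕ}
    (hn : s n = Sum.inr ()) : ∃ k < n, s k ≠ Sum.inr () ∧ s (k + 1) = Sum.inr () := by
  induction n with
  | zero => exact absurd hn (mem_orbitSpace_iff.1 hs).1
  | succ n ih =>
    by_cases h : s n = Sum.inr ()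
    · obtain ⟨k, hk, hk'⟩ := ih h
      exact ⟨k, hk.trans n.lt_succ_self, hk'⟩
    · exact ⟨n, n.lt_succ_self, h, hn⟩

theorem iterate_extendMap_apply {s : ℕ → X ⊕ Unit} (hs : s ∈ orbitSpace φ Y) {n : ℕ}
    (hn : s n ≠ Sum.inr ()) : (extendMap φ)^[n] (s n) = s 0 := by
  induction n with
  | zero => rfl
  | succ n ih =>
    have h := ((mem_orbitSpace_iff.1 hs).2 n).2 hn
    rw [Function.iterate_succ_apply, h.2, ih h.1]

theorem prependImage_mem {s : ℕ → X ⊕ Unit} (hs : s ∈ orbitSpace φ Y)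
    (h0 : extendMap φ (s 0) ≠ Sum.inr ()) : prependImage φ s ∈ orbitSpace φ Y := by
  have h := mem_orbitSpace_iff.1 hs
  refine mem_orbitSpace_iff.2 ⟨h0, fun n => ?_⟩
  cases n with
  | zero => exact ⟨fun h1 => absurd h1 h.1, fun _ => ⟨h0, rfl⟩⟩
  | succ n => exact h.2 n

theorem shift_mem {s : ℕ → X ⊕ Unit} (hs : s ∈ orbitSpace φ Y) (h1 : s 1 ≠ Sum.inr ()) :
    (fun n => s (n + 1)) ∈ orbitSpace φ Y :=
  mem_orbitSpace_iff.2 ⟨h1, fun n => (mem_orbitSpace_iff.1 hs).2 (n + 1)⟩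

/-- A backward orbit starting at a point where `φ^n` is defined is the `n`-th tail of another. -/
theorem exists_orbit_of_tail {t : ℕ → X ⊕ Unit} (ht : t ∈ orbitSpace φ Y) {n : ℕ}
    (hn : (extendMap φ)^[n] (t 0) ≠ Sum.inr ()) :
    ∃ s ∈ orbitSpace φ Y, ∀ j, s (n + j) = t j := by
  induction n with
  | zero => exact ⟨t, ht, fun j => by rw [zero_add]⟩
  | succ n ih =>
    rw [Function.iterate_succ_apply'] at hn
    have hn' : (extendMap φ)^[n] (t 0) ≠ Sum.inr () := fun h => hn (by rw [h, extendMap_inr])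
    obtain ⟨s, hs, hst⟩ := ih hn'
    have hsn : s n = t 0 := hst 0
    have h0 : s 0 = (extendMap φ)^[n] (t 0) := by
      rw [← hsn, iterate_extendMap_apply hs]
      rw [hsn]
      exact (mem_orbitSpace_iff.1 ht).1
    -- Since `s 0 = φ^n(t 0)` still lies in the domain of `φ`, one more image can be put in front.
    refine ⟨prependImage φ s, prependImage_mem hs (h0 ▸ hn), fun j => ?_⟩
    rw [show n + 1 + j = n + j + 1 by ring]
    exact hst j

/-- If `Y` and the image of `φ` cover `X`, then every point starts a backward orbit. -/
theorem exists_orbit_starting_at (hcov : ∀ x, x ∈ Y ∨ ∃ p, extendMap φ p = Sum.inl x) (x : X) :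
    ∃ t ∈ orbitSpace φ Y, t 0 = Sum.inl x := by
  -- One backward step: stop if the point lies in `Y`, otherwise pick a preimage; `0` goes to `0`.
  -- Iterating a choice of such steps builds the orbit.
  have hg : ∀ p : X ⊕ Unit, ∃ q : X ⊕ Unit,
      (q = Sum.inr () → p = Sum.inr () ∨ p ∈ Sum.inl '' Y) ∧
        (q ≠ Sum.inr () → p ≠ Sum.inr () ∧ extendMap φ q = p) := by
    rintro (x | u)
    · obtain hx | ⟨q, hq⟩ := hcov x
      · exact ⟨Sum.inr (), fun _ => Or.inr ⟨x, hx, rfl⟩, fun h => absurd rfl h⟩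
      · refine ⟨q, ?_, fun _ => ⟨by simp, hq⟩⟩
        rintro rfl
        simp at hq
    · exact ⟨Sum.inr (), fun _ => Or.inl rfl, fun h => absurd rfl h⟩
  choose g hg using hg
  refine ⟨fun n => g^[n] (Sum.inl x), mem_orbitSpace_iff.2 ⟨by simp, fun n => ?_⟩, rfl⟩
  simpa only [Function.iterate_succ_apply'] using hg (g^[n] (Sum.inl x))

theorem exists_orbit_through (hcov : ∀ x, x ∈ Y ∨ ∃ p, extendMap φ p = Sum.inl x) {x : X} {n : ℕ}
    (hn : (extendMap φ)^[n] (Sum.inl x) ≠ Sum.inr ()) :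
    ∃ s ∈ orbitSpace φ Y, s n = Sum.inl x := by
  obtain ⟨t, ht, ht0⟩ := exists_orbit_starting_at hcov x
  obtain ⟨s, hs, hst⟩ := exists_orbit_of_tail ht (n := n) (ht0 ▸ hn)
  exact ⟨s, hs, (hst 0).trans ht0⟩

/-- The sequence `(y, 0, 0, …)` is already an orbit because `y ∈ Y`; its forward images are then put
in front of it. -/
theorem exists_orbit_ending_at {y : X} (hy : y ∈ Y) {n : ℕ}
    (hn : (extendMap φ)^[n] (Sum.inl y) ≠ Sum.inr ()) :
    ∃ s ∈ orbitSpace φ Y, s n = Sum.inl y ∧ s (n + 1) = Sum.inr () := by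
  let t : ℕ → X ⊕ Unit := fun n => Nat.casesOn n (Sum.inl y) fun _ => Sum.inr ()
  have ht : t ∈ orbitSpace φ Y := by
    refine mem_orbitSpace_iff.2 ⟨by simp [t], fun n => ⟨fun _ => ?_, fun h => absurd rfl h⟩⟩
    cases n with
    | zero => exact Or.inr ⟨y, hy, rfl⟩
    | succ n => exact Or.inl rfl
  obtain ⟨s, hs, hst⟩ := exists_orbit_of_tail ht (n := n) hn
  exact ⟨s, hs, hst 0, hst 1⟩

/-! ### The topology of the orbit space -/

variable [TopologicalSpace X]

theorem continuous_orbit_apply (n : ℕ) : Continuous fun s : orbitSpace φ Y => s.1 n :=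
  (continuous_apply n).comp continuous_subtype_val

variable [T2Space X]

/-- Every condition on consecutive entries is an implication with open premise, as `0` is isolated,
and closed conclusion, as `Y` is closed and `extendMap φ` is continuous. -/
theorem isClosed_orbitSpace (hc : Continuous (extendMap φ)) (hY : IsClosed Y) :
    IsClosed (orbitSpace φ Y) := by
  have h1 : ∀ n, IsClosed {s : ℕ → X ⊕ Unit | s n ≠ Sum.inr ()} := fun n =>
    (isClosed_ne_inr (X := X)).preimage (continuous_apply (A := fun _ : ℕ => X ⊕ Unit) n)
  have h2 : ∀ n, IsOpen {s : ℕ → X ⊕ Unit | s n ≠ Sum.inr ()} := fun n =>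
    (isOpen_ne_inr (X := X)).preimage (continuous_apply (A := fun _ : ℕ => X ⊕ Unit) n)
  have h3 : ∀ n, IsOpen {s : ℕ → X ⊕ Unit | s n = Sum.inr ()} := fun n => by
    simpa [Set.compl_ofPred] using (h1 n).isOpen_compl
  have h4 : ∀ n, IsClosed {s : ℕ → X ⊕ Unit | s n = Sum.inr ()} := fun n => by
    simpa [Set.compl_ofPred] using (h2 n).isClosed_compl
  have h5 : orbitSpace φ Y = {s | s 0 ≠ Sum.inr () ∧
      ∀ n, (s (n + 1) = Sum.inr () → s n = Sum.inr () ∨ s n ∈ Sum.inl '' Y) ∧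
        (s (n + 1) ≠ Sum.inr () → s n ≠ Sum.inr () ∧ extendMap φ (s (n + 1)) = s n)} :=
    Set.ext fun s => mem_orbitSpace_iff
  rw [h5]
  refine (h1 0).and ?_
  rw [Set.ofPred_forall]
  refine isClosed_iInter fun n => .and ?_ ?_
  · have h6 : IsClosed {s : ℕ → X ⊕ Unit | s n ∈ Sum.inl '' Y} :=
      (Topology.IsClosedEmbedding.inl.isClosedMap Y hY).preimage
        (continuous_apply (A := fun _ : ℕ => X ⊕ Unit) n)
    exact isClosed_imp (h3 (n + 1)) ((h4 n).union h6)
  · exact isClosed_imp (h2 (n + 1)) ((h1 n).and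
      (isClosed_eq (hc.comp (continuous_apply (n + 1))) (continuous_apply n)))

variable [LocallyCompactSpace X] {α : C₀(X, ℂ) →⋆ₙₐ[ℂ] C₀(X, ℂ)}

/-- An ultrafilter on the orbit space converges as soon as one of its coordinates converges to a
point of `X`. -/
theorem IsDual.exists_orbit_le_nhds (hφ : IsDual α φ) (hc : Continuous (extendMap φ))
    (hY : IsClosed Y) {𝒰 : Ultrafilter (orbitSpace φ Y)} {n : ℕ} {p : X ⊕ Unit}
    (hp : p ≠ Sum.inr ()) (h : Tendsto (fun s : orbitSpace φ Y => s.1 n) 𝒰 (𝓝 p)) :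
    ∃ s, 𝒰.1 ≤ 𝓝 s := by
  -- Downwards, convergence propagates by continuity, since each entry is the image of the next one;
  -- being nonzero is a closed condition and survives in the limit.
  have hdown : ∃ q, Tendsto (fun s : orbitSpace φ Y => s.1 0) 𝒰 (𝓝 q) := by
    induction n generalizing p with
    | zero => exact ⟨p, h⟩
    | succ n ih =>
      have hev : ∀ᶠ s : orbitSpace φ Y in 𝒰,
          s.1 n ≠ Sum.inr () ∧ extendMap φ (s.1 (n + 1)) = s.1 n := by
        filter_upwards [h.eventually (isOpen_ne_inr.mem_nhds hp)] with s hs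
        exact ((mem_orbitSpace_iff.1 s.2).2 n).2 hs
      have ht : Tendsto (fun s : orbitSpace φ Y => s.1 n) 𝒰 (𝓝 (extendMap φ p)) :=
        ((hc.tendsto p).comp h).congr' (hev.mono fun s hs => hs.2)
      exact ih (isClosed_ne_inr.mem_of_tendsto ht (hev.mono fun s hs => hs.1)) ht
  -- Upwards, the ultrafilter decides whether the next entry is `0`. If it is not, the images of the
  -- next entries converge in `X`, and properness of `φ` gives a limit.
  have hall : ∀ m, ∃ q, Tendsto (fun s : orbitSpace φ Y => s.1 m) 𝒰 (𝓝 q) := by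
    intro m
    induction m with
    | zero => exact hdown
    | succ m ih =>
      obtain ⟨q, hq⟩ := ih
      rcases 𝒰.em (fun s : orbitSpace φ Y => s.1 (m + 1) = Sum.inr ()) with hev | hev
      · exact ⟨Sum.inr (), tendsto_const_nhds.congr' (hev.mono fun s hs => hs.symm)⟩
      · have hev' : ∀ᶠ s : orbitSpace φ Y in 𝒰,
            s.1 m ≠ Sum.inr () ∧ extendMap φ (s.1 (m + 1)) = s.1 m :=
          hev.mono fun s hs => ((mem_orbitSpace_iff.1 s.2).2 m).2 hs
        obtain ⟨x, rfl⟩ := exists_eq_inl_of_ne_inr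
          (isClosed_ne_inr.mem_of_tendsto hq (hev'.mono fun s hs => hs.1))
        have ht : Tendsto (extendMap φ) (𝒰.map fun s : orbitSpace φ Y => s.1 (m + 1))
            (𝓝 (Sum.inl x)) :=
          tendsto_map'_iff.2 (hq.congr' (hev'.mono fun s hs => hs.2.symm))
        exact hφ.exists_le_nhds ht
  choose q hq using hall
  have ht : Tendsto (fun s : orbitSpace φ Y => s.1) 𝒰 (𝓝 q) := tendsto_pi_nhds.2 hq
  have hmem : q ∈ orbitSpace φ Y :=
    (isClosed_orbitSpace hc hY).mem_of_tendsto ht (Eventually.of_forall fun s => s.2)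
  exact ⟨⟨q, hmem⟩, (tendsto_subtype_rng (f := id)).2 ht⟩

theorem tendsto_cocompact_zero_of_isCompact {Z : Type*} [TopologicalSpace Z] {f : Z → ℂ}
    (h : ∀ ε > 0, IsCompact {z | ε ≤ ‖f z‖}) : Tendsto f (cocompact Z) (𝓝 0) := by
  rw [tendsto_zero_iff_norm_tendsto_zero, Metric.tendsto_nhds]
  intro ε hε
  filter_upwards [(h ε hε).compl_mem_cocompact] with z hz
  simpa using hz

/-- The function `s ↦ a(s_n)` on the orbit space. -/
def IsDual.coordFun (hφ : IsDual α φ) (hc : Continuous (extendMap φ)) (hY : IsClosed Y) (n : ℕ)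
    (a : C₀(X, ℂ)) : C₀(orbitSpace φ Y, ℂ) where
  toFun s := pointEval (s.1 n) a
  continuous_toFun := (continuous_pointEval a).comp (continuous_orbit_apply n)
  zero_at_infty' := by
    refine tendsto_cocompact_zero_of_isCompact fun ε hε => isCompact_iff_ultrafilter_le_nhds.2 ?_
    intro 𝒰 h𝒰
    have hcl : IsClosed {s : orbitSpace φ Y | ε ≤ ‖pointEval (s.1 n) a‖} :=
      isClosed_le continuous_const
        ((continuous_pointEval a).comp (continuous_orbit_apply n)).norm
    -- The `n`-th coordinate stays in a compact set that omits `0`, so it converges to a point of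
    -- `X`, and the whole orbit converges with it.
    obtain ⟨p, hp, hp'⟩ := (isCompact_le_norm_pointEval a hε).ultrafilter_le_nhds
      (𝒰.map fun s : orbitSpace φ Y => s.1 n)
      (le_principal_iff.2 (Ultrafilter.mem_map.2 (le_principal_iff.1 h𝒰)))
    have hpne : p ≠ Sum.inr () := by
      rintro rfl
      exact hε.not_ge (by simpa using hp)
    obtain ⟨s, hs⟩ := hφ.exists_orbit_le_nhds hc hY hpne hp'
    exact ⟨s, isClosed_iff_ultrafilter.1 hcl s 𝒰 hs (le_principal_iff.1 h𝒰), hs⟩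

end BackwardOrbits

/-! ### The stages as functions on the orbit space -/

section StageFunctions

variable {X : Type*}

/-- The indicator function of the extra point `0` of `X ⊔ {0}`. -/
def zeroIndicator : X ⊕ Unit → ℂ := Sum.elim 0 1

@[simp]
theorem zeroIndicator_inr (u : Unit) : zeroIndicator (X := X) (Sum.inr u) = 1 := rfl

theorem zeroIndicator_of_ne {p : X ⊕ Unit} (hp : p ≠ Sum.inr ()) : zeroIndicator p = 0 := by
  obtain ⟨x, rfl⟩ := exists_eq_inl_of_ne_inr hp
  rfl

theorem norm_zeroIndicator_le (p : X ⊕ Unit) : ‖zeroIndicator p‖ ≤ 1 := by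
  rcases p with x | u <;> simp [zeroIndicator]

variable [TopologicalSpace X] {Δ : Set X} {φ : Δ → X} {Y : Set X}
  {J : ClosedIdeal C₀(X, ℂ)}

open Classical in
variable (J) in
/-- Evaluation on `C₀(X) / J` at a point at which `J` vanishes. -/
def quotEval (p : X ⊕ Unit) : J.Quotient →⋆ₙₐ[ℂ] ℂ :=
  if h : ∀ a ∈ J, pointEval p a = 0 then J.lift (pointEval p) h else 0

theorem quotEval_proj (hJY : ∀ a : C₀(X, ℂ), a ∈ J ↔ ∀ y ∈ Y, a y = 0) {p : X ⊕ Unit}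
    (hp : p = Sum.inr () ∨ p ∈ Sum.inl '' Y) (a : C₀(X, ℂ)) :
    quotEval J p (J.proj a) = pointEval p a := by
  have h : ∀ a ∈ J, pointEval p a = 0 := by
    obtain rfl | ⟨y, hy, rfl⟩ := hp
    · exact fun a _ => rfl
    · exact fun a ha => (hJY a).1 ha y hy
  rw [quotEval, dif_pos h, ClosedIdeal.lift_proj]

theorem quotEval_inr (hJY : ∀ a : C₀(X, ℂ), a ∈ J ↔ ∀ y ∈ Y, a y = 0) (q : J.Quotient) :
    quotEval J (Sum.inr ()) q = 0 := by
  obtain ⟨a, rfl⟩ := J.proj_surjective q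
  rw [quotEval_proj hJY (Or.inl rfl), pointEval_inr]

theorem continuous_zeroIndicator : Continuous (zeroIndicator (X := X)) :=
  continuous_const.sumElim continuous_const

/-- The function on sequences given by `a_0 ⊕ ⋯ ⊕ a_{n-1} ⊕ a_n`: the value is `a_k(s_k)` if `s_k`
is the last nonzero entry and `k < n`, and `a_n(s_n)` if `s_n` is nonzero. -/
def stageValue (n : ℕ) (w : (Fin n → J.Quotient) × C₀(X, ℂ)) (s : ℕ → X ⊕ Unit) : ℂ :=
  ∑ k : Fin n, zeroIndicator (s (k + 1)) * quotEval J (s k) (w.1 k) + pointEval (s n) w.2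

theorem stageValue_of_ne_inr {s : ℕ → X ⊕ Unit} (hs : s ∈ orbitSpace φ Y) {n : ℕ}
    (hn : s n ≠ Sum.inr ()) (w : (Fin n → J.Quotient) × C₀(X, ℂ)) :
    stageValue n w s = pointEval (s n) w.2 := by
  rw [stageValue, Finset.sum_eq_zero, zero_add]
  intro k _
  rw [zeroIndicator_of_ne (ne_inr_of_le hs k.2 hn), zero_mul]

theorem stageValue_of_last (hJY : ∀ a : C₀(X, ℂ), a ∈ J ↔ ∀ y ∈ Y, a y = 0) {s : ℕ → X ⊕ Unit}
    (hs : s ∈ orbitSpace φ Y) {n : ℕ} (k : Fin n) (hk : s k ≠ Sum.inr ())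
    (hk' : s (k + 1) = Sum.inr ()) (w : (Fin n → J.Quotient) × C₀(X, ℂ)) :
    stageValue n w s = quotEval J (s k) (w.1 k) := by
  have hgt : ∀ m, (k : ℕ) < m → s m = Sum.inr () := fun m hm => by
    by_contra h
    exact ne_inr_of_le hs hm h hk'
  rw [stageValue, hgt n k.2, pointEval_inr, add_zero, Finset.sum_eq_single k]
  · rw [hk', zeroIndicator_inr, one_mul]
  · intro j _ hj
    rcases lt_or_gt_of_ne hj with h | h
    · rw [zeroIndicator_of_ne (ne_inr_of_le hs h hk), zero_mul]
    · rw [hgt j h, quotEval_inr hJY, mul_zero]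
  · exact fun h => absurd (Finset.mem_univ k) h

/-- At a fixed orbit at most one summand survives, and the choice of summand does not depend on `w`.
Hence the value is multiplicative in `w` although it is defined as a sum. -/
theorem stageValue_cases (hJY : ∀ a : C₀(X, ℂ), a ∈ J ↔ ∀ y ∈ Y, a y = 0) {s : ℕ → X ⊕ Unit}
    (hs : s ∈ orbitSpace φ Y) (n : ℕ) :
    (∀ w : (Fin n → J.Quotient) × C₀(X, ℂ), stageValue n w s = pointEval (s n) w.2) ∨
      ∃ k : Fin n, ∀ w : (Fin n → J.Quotient) × C₀(X, ℂ),
        stageValue n w s = quotEval J (s k) (w.1 k) := by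
  by_cases hn : s n = Sum.inr ()
  · obtain ⟨k, hk, h1, h2⟩ := exists_last_of_eq_inr hs hn
    exact Or.inr ⟨⟨k, hk⟩, stageValue_of_last hJY hs ⟨k, hk⟩ h1 h2⟩
  · exact Or.inl (stageValue_of_ne_inr hs hn)

/-! ### Compatibility with the structure maps, and faithfulness of the stages. -/

variable {α : C₀(X, ℂ) →⋆ₙₐ[ℂ] C₀(X, ℂ)}

theorem IsDual.stageValue_snocHom (hφ : IsDual α φ)
    (hJY : ∀ a : C₀(X, ℂ), a ∈ J ↔ ∀ y ∈ Y, a y = 0) {s : ℕ → X ⊕ Unit}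
    (hs : s ∈ orbitSpace φ Y) (n : ℕ) (w : (Fin n → J.Quotient) × C₀(X, ℂ)) :
    stageValue (n + 1) (snocHom α J n w) s = stageValue n w s := by
  have h1 : (snocHom α J n w).1 = Fin.snoc (α := fun _ => J.Quotient) w.1 (J.proj w.2) := rfl
  have h2 : (snocHom α J n w).2 = α w.2 := rfl
  rw [stageValue, stageValue, Fin.sum_univ_castSucc, h1, h2, add_assoc]
  congr 1
  · simp
  · rw [Fin.snoc_last, Fin.val_last, hφ.pointEval_map]
    have h := (mem_orbitSpace_iff.1 hs).2 n
    by_cases hn : s (n + 1) = Sum.inr ()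
    · rw [hn, quotEval_proj hJY (h.1 hn)]
      simp
    · rw [zeroIndicator_of_ne hn, (h.2 hn).2, zero_mul, zero_add]

/-- The lost first summand contributes nothing at the prepended orbit: its factor is the indicator
of `s 0` being `0`. The other terms agree after the index shift. -/
theorem stageValue_tailHom {s : ℕ → X ⊕ Unit} (h0 : s 0 ≠ Sum.inr ()) (n : ℕ)
    (w : (Fin (n + 1) → J.Quotient) × C₀(X, ℂ)) :
    stageValue n (tailHom J n w) s = stageValue (n + 1) w (prependImage φ s) := by
  rw [stageValue, stageValue, Fin.sum_univ_succ]
  change _ = zeroIndicator (s 0) * _ + _ + _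
  rw [zeroIndicator_of_ne h0, zero_mul, zero_add]
  rfl

/-- After the shift, the entry evaluated at `s k` comes from the corner with index `k + 1`, while
`φ^{k+1}` is undefined at `s k` because `φ^k(s k) = s 0 ∉ Δ`. -/
theorem IsDual.stageValue_tailHom_eq_zero (hφ : IsDual α φ)
    (hJY : ∀ a : C₀(X, ℂ), a ∈ J ↔ ∀ y ∈ Y, a y = 0) {s : ℕ → X ⊕ Unit}
    (hs : s ∈ orbitSpace φ Y) (h0 : extendMap φ (s 0) = Sum.inr ()) (n : ℕ)
    {w : (Fin (n + 1) → J.Quotient) × C₀(X, ℂ)} (hw : w ∈ stage α J (n + 1)) :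
    stageValue n (tailHom J n w) s = 0 := by
  have hit : ∀ m, (extendMap φ)^[m + 1] (s m) = Sum.inr () := fun m => by
    by_cases hm : s m = Sum.inr ()
    · rw [hm]
      exact Function.iterate_fixed (extendMap_inr _) _
    · rw [Function.iterate_succ_apply', iterate_extendMap_apply hs hm, h0]
  by_cases hn : s n = Sum.inr ()
  · obtain ⟨k, hk, h1, h2⟩ := exists_last_of_eq_inr hs hn
    rw [stageValue_of_last hJY hs ⟨k, hk⟩ h1 h2]
    obtain ⟨a, ha, haw⟩ := hw.1 (Fin.succ ⟨k, hk⟩)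
    change quotEval J (s k) (w.1 (Fin.succ ⟨k, hk⟩)) = 0
    rw [← haw]
    exact (quotEval_proj hJY (((mem_orbitSpace_iff.1 hs).2 k).1 h2) a).trans
      (hφ.pointEval_eq_zero_of_mem_corner ha (hit k))
  · rw [stageValue_of_ne_inr hs hn]
    exact hφ.pointEval_eq_zero_of_mem_corner hw.2 (hit n)

/-- Orbits ending at `y ∈ Y` with index `k` test the summand `k`; orbits through `x` at index `n`,
supplied by the covering of `X`, test the last one. Points reached by no such orbit are those where
the iterate of `φ` is undefined, and corner elements vanish there. -/
theorem IsDual.stageHom_injective (hφ : IsDual α φ)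
    (hcov : ∀ x, x ∈ Y ∨ ∃ p, extendMap φ p = Sum.inl x)
    (hJY : ∀ a : C₀(X, ℂ), a ∈ J ↔ ∀ y ∈ Y, a y = 0) {n : ℕ}
    {f : Stage α J n →⋆ₙₐ[ℂ] C₀(orbitSpace φ Y, ℂ)}
    (hf : ∀ z s, f z s = stageValue n (stageIncl α J n z) s.1) : Function.Injective f := by
  rw [injective_iff_map_eq_zero]
  intro z hz
  have h0 : ∀ s ∈ orbitSpace φ Y, stageValue n (stageIncl α J n z) s = 0 := fun s hs => by
    rw [← hf z ⟨s, hs⟩, hz, ZeroAtInftyContinuousMap.zero_apply]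
  have hz1 : ∀ k : Fin n, (stageIncl α J n z).1 k ∈ (corner α k).map J.proj := z.2.1
  have hz2 : (stageIncl α J n z).2 ∈ corner α n := z.2.2
  refine Subtype.ext (Prod.ext (funext fun k => ?_) ?_)
  · change (stageIncl α J n z).1 k = 0
    obtain ⟨a, ha, haz⟩ := hz1 k
    change J.proj a = _ at haz
    rw [← haz, ClosedIdeal.proj_eq_zero, hJY]
    intro y hy
    by_cases hk : (extendMap φ)^[k] (Sum.inl y) = Sum.inr ()
    · exact hφ.pointEval_eq_zero_of_mem_corner ha hk
    · obtain ⟨s, hs, hsk, hsk'⟩ := exists_orbit_ending_at hy hk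
      have h := h0 s hs
      rw [stageValue_of_last hJY hs k (by simp [hsk]) hsk', ← haz,
        quotEval_proj hJY (Or.inr ⟨y, hy, hsk.symm⟩), hsk] at h
      exact h
  · change (stageIncl α J n z).2 = 0
    ext x
    by_cases hx : (extendMap φ)^[n] (Sum.inl x) = Sum.inr ()
    · exact hφ.pointEval_eq_zero_of_mem_corner hz2 hx
    · obtain ⟨s, hs, hsn⟩ := exists_orbit_through hcov hx
      have h := h0 s hs
      rw [stageValue_of_ne_inr hs (by simp [hsn]), hsn] at h
      exact h

/-- Elements of the last summand of a stage. -/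
theorem exists_stage_of_mem_corner (J : ClosedIdeal C₀(X, ℂ)) {n : ℕ} {a : C₀(X, ℂ)}
    (ha : a ∈ corner α n) :
    ∃ z : Stage α J n, stageIncl α J n z = (0, a) :=
  ⟨⟨(0, a), fun _ => zero_mem _, ha⟩, rfl⟩

open Classical in
/-- The partial homeomorphism `(x_0, x_1, …) ↦ (φ(x_0), x_0, x_1, …)` of the orbit space. -/
def orbitPartialHomeomorph (hc : Continuous (extendMap φ)) (Y : Set X) :
    OpenPartialHomeomorph (orbitSpace φ Y) (orbitSpace φ Y) where
  -- Outside `source` and `target` the two maps are the identity, a default value only.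
  toFun s := if h : extendMap φ (s.1 0) ≠ Sum.inr () then ⟨_, prependImage_mem s.2 h⟩ else s
  invFun s := if h : s.1 1 ≠ Sum.inr () then ⟨_, shift_mem s.2 h⟩ else s
  source := {s | extendMap φ (s.1 0) ≠ Sum.inr ()}
  target := {s | s.1 1 ≠ Sum.inr ()}
  map_source' s hs := by
    rw [Set.mem_ofPred_eq] at hs
    rw [Set.mem_ofPred_eq, dif_pos hs]
    exact (mem_orbitSpace_iff.1 s.2).1
  map_target' s hs := by
    rw [Set.mem_ofPred_eq] at hs
    rw [Set.mem_ofPred_eq, dif_pos hs]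
    change extendMap φ (s.1 1) ≠ Sum.inr ()
    have h := ((mem_orbitSpace_iff.1 s.2).2 0).2 hs
    exact h.2 ▸ h.1
  left_inv' s hs := by
    rw [Set.mem_ofPred_eq] at hs
    rw [dif_pos hs, dif_pos (show prependImage φ s.1 1 ≠ _ from (mem_orbitSpace_iff.1 s.2).1)]
    rfl
  right_inv' s hs := by
    rw [Set.mem_ofPred_eq] at hs
    have h := ((mem_orbitSpace_iff.1 s.2).2 0).2 hs
    rw [dif_pos hs, dif_pos (show extendMap φ (s.1 1) ≠ _ from h.2 ▸ h.1)]
    refine Subtype.ext (funext fun n => ?_)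
    cases n with
    | zero => exact h.2
    | succ n => rfl
  open_source := isOpen_ne_inr.preimage (hc.comp (continuous_orbit_apply 0))
  open_target := isOpen_ne_inr.preimage (continuous_orbit_apply 1)
  continuousOn_toFun := by
    have h : Continuous fun s : orbitSpace φ Y => prependImage φ s.1 := by
      refine continuous_pi fun n => ?_
      cases n with
      | zero => exact hc.comp (continuous_orbit_apply 0)
      | succ n => exact continuous_orbit_apply n
    refine IsInducing.subtypeVal.continuousOn_iff.2 (h.continuousOn.congr fun s hs => ?_)
    rw [Set.mem_ofPred_eq] at hs
    simp [hs]
  continuousOn_invFun := by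
    have h : Continuous fun (s : orbitSpace φ Y) n => s.1 (n + 1) :=
      continuous_pi fun n => continuous_orbit_apply (n + 1)
    refine IsInducing.subtypeVal.continuousOn_iff.2 (h.continuousOn.congr fun s hs => ?_)
    rw [Set.mem_ofPred_eq] at hs
    simp [hs]

theorem orbitPartialHomeomorph_apply (hc : Continuous (extendMap φ)) {s : orbitSpace φ Y}
    (hs : s ∈ (orbitPartialHomeomorph hc Y).source) :
    (orbitPartialHomeomorph hc Y s).1 = prependImage φ s.1 :=
  congrArg Subtype.val (dif_pos hs)

theorem orbitPartialHomeomorph_symm_apply (hc : Continuous (extendMap φ)) {s : orbitSpace φ Y}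
    (hs : s ∈ (orbitPartialHomeomorph hc Y).target) (n : ℕ) :
    ((orbitPartialHomeomorph hc Y).symm s).1 n = s.1 (n + 1) :=
  congrFun (congrArg Subtype.val (dif_pos hs)) n

variable [T2Space X] [LocallyCompactSpace X]

theorem IsDual.exists_zeroAtInfty_stageValue (hφ : IsDual α φ) (hc : Continuous (extendMap φ))
    (hY : IsClosed Y) (hJY : ∀ a : C₀(X, ℂ), a ∈ J ↔ ∀ y ∈ Y, a y = 0) (n : ℕ)
    (w : (Fin n → J.Quotient) × C₀(X, ℂ)) :
    ∃ F : C₀(orbitSpace φ Y, ℂ), ∀ s, F s = stageValue n w s.1 := by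
  choose a ha using fun k => J.proj_surjective (w.1 k)
  let g : Fin n → C₀(orbitSpace φ Y, ℂ) := fun k =>
    { toFun := fun s => zeroIndicator (s.1 (k + 1)) * hφ.coordFun hc hY k (a k) s
      continuous_toFun := (continuous_zeroIndicator.comp (continuous_orbit_apply _)).mul
        (map_continuous _)
      zero_at_infty' := by
        refine squeeze_zero_norm (fun s => ?_)
          (tendsto_zero_iff_norm_tendsto_zero.1 (zero_at_infty (hφ.coordFun hc hY k (a k))))
        rw [norm_mul]
        exact mul_le_of_le_one_left (norm_nonneg _) (norm_zeroIndicator_le _) }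
  -- The choice of representative `a k` is harmless: the indicator is nonzero only if the next entry
  -- is `0`, and then the current entry lies in `Y` or is `0`.
  have hg : ∀ k s, g k s = zeroIndicator (s.1 (k + 1)) * quotEval J (s.1 k) (w.1 k) := by
    intro k s
    change zeroIndicator (s.1 (k + 1)) * pointEval (s.1 k) (a k) = _
    by_cases hk : s.1 (k + 1) = Sum.inr ()
    · rw [← ha, quotEval_proj hJY (((mem_orbitSpace_iff.1 s.2).2 k).1 hk)]
    · rw [zeroIndicator_of_ne hk, zero_mul, zero_mul]
  refine ⟨∑ k, g k + hφ.coordFun hc hY n w.2, fun s => ?_⟩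
  have hsum : (∑ k, g k) s = ∑ k, g k s :=
    map_sum (pointEval (X := orbitSpace φ Y) (Sum.inl s)) g Finset.univ
  rw [ZeroAtInftyContinuousMap.add_apply, hsum]
  simp only [hg]
  rfl

/-- The ⋆-homomorphisms from the stages to the functions on the orbit space. -/
theorem IsDual.exists_stageHom (hφ : IsDual α φ) (hc : Continuous (extendMap φ))
    (hY : IsClosed Y) (hJY : ∀ a : C₀(X, ℂ), a ∈ J ↔ ∀ y ∈ Y, a y = 0) (n : ℕ) :
    ∃ f : Stage α J n →⋆ₙₐ[ℂ] C₀(orbitSpace φ Y, ℂ),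
      ∀ z s, f z s = stageValue n (stageIncl α J n z) s.1 := by
  choose F hF using hφ.exists_zeroAtInfty_stageValue hc hY hJY n
  refine ⟨NonUnitalStarAlgHom.comp (B := (Fin n → J.Quotient) × C₀(X, ℂ)) {
    toFun := F
    map_smul' := fun c v => ?_
    map_zero' := ?_
    map_add' := fun v w => ?_
    map_mul' := fun v w => ?_
    map_star' := fun v => ?_ } (stageIncl α J n), fun z s => hF _ s⟩
  all_goals
    ext s
    obtain h | ⟨k, h⟩ := stageValue_cases hJY s.2 n <;> simp [hF, h, map_star]

/-- Some element of some stage separates two given backward orbits. -/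
theorem IsDual.exists_stageValue_ne (hφ : IsDual α φ) (J : ClosedIdeal C₀(X, ℂ))
    {s t : ℕ → X ⊕ Unit} (hs : s ∈ orbitSpace φ Y) (ht : t ∈ orbitSpace φ Y) (hst : s ≠ t) :
    ∃ n, ∃ z : Stage α J n,
      stageValue n (stageIncl α J n z) s ≠ stageValue n (stageIncl α J n z) t := by
  obtain ⟨n, hn⟩ := Function.ne_iff.1 hst
  -- By symmetry one may assume that `s n` lies in `X`. Then `φ^n(s n) = s 0` is defined, and a
  -- corner element placed in the last summand, with zeros before it, separates the orbits.
  have key : ∀ {s t : ℕ → X ⊕ Unit}, s ∈ orbitSpace φ Y → s n ≠ t n → s n ≠ Sum.inr () →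
      ∃ z : Stage α J n,
        stageValue n (stageIncl α J n z) s ≠ stageValue n (stageIncl α J n z) t := by
    intro s t hs hn hsn
    have hit : (extendMap φ)^[n] (s n) ≠ Sum.inr () := by
      rw [iterate_extendMap_apply hs hsn]
      exact (mem_orbitSpace_iff.1 hs).1
    obtain ⟨a, ha, has, hat⟩ := hφ.exists_mem_corner hn hit
    obtain ⟨z, hz⟩ := exists_stage_of_mem_corner J ha
    refine ⟨z, ?_⟩
    simpa [hz, stageValue, hat] using has
  by_cases hsn : s n = Sum.inr ()
  · obtain ⟨z, hz⟩ := key ht hn.symm (fun h => hn (hsn.trans h.symm))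
    exact ⟨n, z, hz.symm⟩
  · exact ⟨n, key hs hn hsn⟩

end StageFunctions

/-! ### The spectrum of the natural reversible extension -/

section Spectrum

variable {X : Type*} [TopologicalSpace X] [T2Space X] [LocallyCompactSpace X]
  {α : C₀(X, ℂ) →⋆ₙₐ[ℂ] C₀(X, ℂ)}
  {J : ClosedIdeal C₀(X, ℂ)} {Δ : Set X} {φ : Δ → X} {Y : Set X}

/-- The natural reversible extension as an algebra of functions on the orbit space. -/
theorem IsDual.exists_natExt_rep (hφ : IsDual α φ) (hc : Continuous (extendMap φ))
    (hcov : ∀ x, x ∈ Y ∨ ∃ p, extendMap φ p = Sum.inl x) (hY : IsClosed Y)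
    (hJY : ∀ a : C₀(X, ℂ), a ∈ J ↔ ∀ y ∈ Y, a y = 0) :
    ∃ Γ : NatExt α J →⋆ₙₐ[ℂ] C₀(orbitSpace φ Y, ℂ), Function.Injective Γ ∧
      (∀ s t, s ≠ t → ∃ b, Γ b s ≠ Γ b t) ∧
      (∀ a s, Γ (natExtEmb α J a) s = pointEval (s.1 0) a) ∧
      ∀ b s, (∀ t : orbitSpace φ Y, extendMap φ (s.1 0) ≠ Sum.inr () →
          t.1 = prependImage φ s.1 → Γ (natExtEndo α J b) s = Γ b t) ∧
        (extendMap φ (s.1 0) = Sum.inr () → Γ (natExtEndo α J b) s = 0) := by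
  choose f hf using hφ.exists_stageHom hc hY hJY
  have hcomp : ∀ n z, f (n + 1) (bond α J n z) = f n z := fun n z => by
    ext s
    rw [hf, hf]
    exact hφ.stageValue_snocHom hJY s.2 n (stageIncl α J n z)
  obtain ⟨Γ, hΓ⟩ := Limit.exists_lift f hcomp
  have hpt : ∀ (b : NatExt α J) (x : lp (Stage α J) ∞),
      (nullIdeal (Stage α J)).proj x = Limit.incl _ b → ∀ s,
      Tendsto (fun n => f n (x n) s) atTop (𝓝 (Γ b s)) := fun b x hx s =>
    ((map_continuous (pointEval (Sum.inl s))).tendsto (Γ b)).comp (hΓ b x hx)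
  refine ⟨Γ, Limit.injective_of_tendsto f (fun n => hφ.stageHom_injective hcov hJY (hf n)) hΓ,
    fun s t hst => ?_, fun a s => ?_, fun b s => ?_⟩
  · obtain ⟨n, z, hz⟩ := hφ.exists_stageValue_ne J s.2 t.2 fun h => hst (Subtype.ext h)
    obtain ⟨b, hb⟩ := Limit.exists_apply_eq f hcomp hΓ n z
    exact ⟨b, by rwa [hb, hf, hf]⟩
  · rw [Limit.apply_eq_of_coherent f hcomp hΓ (b := natExtEmb α J a)
      (x := orbitHom (bond α J) (toStageZero α J a)) rfl (N := 0) (fun _ _ => rfl)]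
    refine (hf 0 _ s).trans ?_
    rw [stageValue, Fin.sum_univ_zero, zero_add]
    rfl
  · obtain ⟨x, hx⟩ := (nullIdeal (Stage α J)).proj_surjective (Limit.incl _ b)
    -- Applying the stage endomorphisms termwise to a representative of `b` gives a representative
    -- of `β(b)`.
    have hβ : (nullIdeal (Stage α J)).proj (seqMap (stageEndo α J) x) =
        Limit.incl _ (natExtEndo α J b) := by
      change _ = seqQuotientMap (stageEndo α J) (Limit.incl _ b)
      rw [← hx]
      exact ((nullIdeal (Stage α J)).lift_proj
        ((nullIdeal (Stage α J)).proj.comp (seqMap (stageEndo α J))) _ x).symm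
    have hlim := hpt _ _ hβ s
    simp only [seqMap_apply, hf] at hlim
    refine ⟨fun t ht hts => ?_, fun h0 => ?_⟩
    -- At each stage, deleting the first summand prepends `φ(s_0)` to the orbit, and the bonding map
    -- that came before it does not change the value there.
    · refine tendsto_nhds_unique (hlim.congr fun n => ?_) (hpt b x hx t)
      rw [hf, hts, ← hφ.stageValue_snocHom hJY (prependImage_mem s.2 ht)]
      exact stageValue_tailHom (mem_orbitSpace_iff.1 s.2).1 n _
    · refine tendsto_nhds_unique (hlim.congr fun n => ?_) tendsto_const_nhds
      exact hφ.stageValue_tailHom_eq_zero hJY s.2 h0 n (snocHom_mem α J n (x n).2)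

end Spectrum

end CStarDyn
end

theorem mainTheorem12 {X : Type*} [TopologicalSpace X] [T2Space X] [LocallyCompactSpace X]
    (α : C₀(X, ℂ) →⋆ₙₐ[ℂ] C₀(X, ℂ)) (hα : CStarDyn.IsExtendible α)
    (J : CStarDyn.ClosedIdeal C₀(X, ℂ)) (hJ : ∀ a ∈ J, ∀ b, α b = 0 → a * b = 0)
    (Δ : Set X) (φ : Δ → X)
    (hφ : ∀ (a : C₀(X, ℂ)) (x : X),
      (∀ hx : x ∈ Δ, α a x = a (φ ⟨x, hx⟩)) ∧ (x ∉ Δ → α a x = 0))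
    (Y : Set X) (hY : IsClosed Y) (hJY : ∀ a : C₀(X, ℂ), a ∈ J ↔ ∀ y ∈ Y, a y = 0) :
    ∃ (h : WeakDual.characterSpace ℂ (CStarDyn.NatExt α J) ≃ₜ CStarDyn.orbitSpace φ Y)
      (ψ : OpenPartialHomeomorph (CStarDyn.orbitSpace φ Y) (CStarDyn.orbitSpace φ Y)),
      -- `A` acts on the orbit space through the coordinate `x_0`
      (∀ (a : C₀(X, ℂ)) (s : CStarDyn.orbitSpace φ Y) (x : X), s.1 0 = Sum.inl x →
        h.symm s (CStarDyn.natExtEmb α J a) = a x) ∧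
      -- `ψ` is the partial homeomorphism dual to `β`
      (∀ (b : CStarDyn.NatExt α J) (s : CStarDyn.orbitSpace φ Y),
        (s ∈ ψ.source → h.symm s (CStarDyn.natExtEndo α J b) = h.symm (ψ s) b) ∧
        (s ∉ ψ.source → h.symm s (CStarDyn.natExtEndo α J b) = 0)) ∧
      IsClosed ψ.source ∧ IsClosed ψ.target ∧
      (∀ s : CStarDyn.orbitSpace φ Y, s ∈ ψ.source ↔ ∃ x ∈ Δ, s.1 0 = Sum.inl x) ∧
      (∀ s : CStarDyn.orbitSpace φ Y, s ∈ ψ.target ↔ s.1 1 ≠ Sum.inr ()) ∧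
      (∀ s ∈ ψ.source, (∀ x : Δ, s.1 0 = Sum.inl x.1 → (ψ s).1 0 = Sum.inl (φ x)) ∧
        ∀ n, (ψ s).1 (n + 1) = s.1 n) ∧
      (∀ s ∈ ψ.target, ∀ n, (ψ.symm s).1 n = s.1 (n + 1)) := by
  replace hφ : CStarDyn.IsDual α φ := hφ
  have hc := hφ.continuous_extendMap (hφ.isClopen hα).isClosed
  have hcov := hφ.mem_or_exists_extendMap_eq hc hJ hY hJY
  obtain ⟨Γ, hΓ, hsep, hemb, hendo⟩ := hφ.exists_natExt_rep hc hcov hY hJY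
  have h0 : ∀ s : CStarDyn.orbitSpace φ Y, ∃ b, Γ b s ≠ 0 := fun s => by
    obtain ⟨x, hx⟩ := CStarDyn.exists_eq_inl_of_ne_inr (CStarDyn.mem_orbitSpace_iff.1 s.2).1
    -- The entry `x_0` of an orbit is always a point of `X`, so the image of `A` alone already
    -- vanishes nowhere.
    obtain ⟨a, ha, -⟩ := CStarDyn.exists_zeroAtInfty_bump x univ_mem
    exact ⟨CStarDyn.natExtEmb α J a, by simp [hemb, hx, ha]⟩
  obtain ⟨h, hh⟩ := CStarDyn.exists_characterSpace_homeomorph Γ hΓ h0 hsep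
  refine ⟨h, CStarDyn.orbitPartialHomeomorph hc Y, ?_, ?_, ?_, ?_, ?_, ?_, ?_, ?_⟩
  · intro a s x hx
    exact (hh s _).trans (by rw [hemb, hx, CStarDyn.pointEval_inl])
  · intro b s
    refine ⟨fun hs => ?_, fun hs => ?_⟩
    · exact (hh s _).trans (((hendo b s).1 _ hs
        (CStarDyn.orbitPartialHomeomorph_apply hc hs)).trans (hh _ b).symm)
    · exact (hh s _).trans ((hendo b s).2 (not_not.1 hs))
  · exact CStarDyn.isClosed_ne_inr.preimage (hc.comp (CStarDyn.continuous_orbit_apply 0))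
  · exact CStarDyn.isClosed_ne_inr.preimage (CStarDyn.continuous_orbit_apply 1)
  · exact fun s => CStarDyn.extendMap_ne_inr_iff
  · exact fun s => Iff.rfl
  · intro s hs
    rw [CStarDyn.orbitPartialHomeomorph_apply hc hs]
    refine ⟨fun x hx => ?_, fun n => rfl⟩
    change CStarDyn.extendMap φ (s.1 0) = _
    rw [hx, CStarDyn.extendMap_of_mem x.2]
  · exact fun s hs => CStarDyn.orbitPartialHomeomorph_symm_apply hc hs
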